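/- Let $n\ge 1$ and $k\ge 3$ be integers, let $\epsilon>0$, and let $z_1,\dots,z_k$ be i.i.d. random vectors in $\mathbb R^n$ with the standard Gaussian law $\mathcal N(0,\mathbf I_n)$. Let $\mathbf S_n$ be the space of real symmetric $n\times n$ matrices with the inner product $\langle X,Y\rangle=\mathbf{Tr}(X^TY)$ and the associated Frobenius norm $\|\cdot\|_F$, and let $\lambda_{\max}(X)$ denote the largest eigenvalue of $X\in\mathbf S_n$. For $X\in\mathbf S_n$ put $$\mathsf F_k(X)=\mathop{\bf E}\Big[\max_{i=1,\dots,k}\lambda_{\max}\Big(X+\frac{\epsilon}{n}z_iz_i^T\Big)\Big].$$ Then this expectation is finite for every $X\in\mathbf S_n$, the function $\mathsf F_k:\mathbf S_n\to\mathbb R$ is (Fréchet) differentiable on all of $\mathbf S_n$, and its gradient with respect to $\langle\cdot,\cdot\rangle$ is Lipschitz continuous with respect to the Frobenius norm, with $$\|\nabla\mathsf F_k(X)-\nabla\mathsf F_k(Y)\|_F\le \frac{k}{k-2}\,\frac{n}{\epsilon}\,\|X-Y\|_F\qquad\text{for all }X,Y\in\mathbf S_n .$$ -/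

import Mathlib

open MeasureTheory ProbabilityTheory

noncomputable section

/-- The Euclidean space of real symmetric `n × n` matrices. It is a subspace of the Euclidean space
of all arrays of `n × n` real entries, so that its inner product is the trace inner product
`⟪X, Y⟫ = ∑ i j, X i j * Y i j = Tr (Xᵀ Y)` and its norm is the Frobenius norm. -/
def SymMatrix (n : ℕ) : Submodule ℝ (EuclideanSpace ℝ (Fin n × Fin n)) where
  carrier := {X | ∀ i j, X (i, j) = X (j, i)}
  add_mem' := by
    intro X Y hX hY i j
    simp [hX i j, hY i j]
  zero_mem' := by
    intro i j
    simp
  smul_mem' := by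
    intro c X hX i j
    simp [hX i j]

/-- The underlying matrix of an element of `SymMatrix n`. -/
def symToMatrix {n : ℕ} (X : SymMatrix n) : Matrix (Fin n) (Fin n) ℝ :=
  Matrix.of fun i j => X.1 (i, j)

theorem symMatrix_inner_eq_trace {n : ℕ} (X Y : SymMatrix n) :
    inner ℝ X Y = ((symToMatrix X).transpose * symToMatrix Y).trace := by
  simp only [Submodule.coe_inner, PiLp.inner_apply, RCLike.inner_apply, conj_trivial,
    Fintype.sum_prod_type, Matrix.trace, Matrix.diag_apply, Matrix.mul_apply,
    Matrix.transpose_apply, symToMatrix, Matrix.of_apply]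
  rw [Finset.sum_comm]
  exact Finset.sum_congr rfl fun i _ => Finset.sum_congr rfl fun j _ => mul_comm _ _

theorem symMatrix_norm_sq {n : ℕ} (X : SymMatrix n) :
    ‖X‖ ^ 2 = ∑ i, ∑ j, symToMatrix X i j ^ 2 := by
  rw [Submodule.coe_norm, EuclideanSpace.real_norm_sq_eq, Fintype.sum_prod_type]
  rfl

theorem isHermitian_symToMatrix {n : ℕ} (X : SymMatrix n) : (symToMatrix X).IsHermitian := by
  ext i j
  exact X.2 j i

/-- The largest eigenvalue of a real symmetric matrix of positive size. -/
def lambdaMax {n : ℕ} (A : Matrix (Fin n) (Fin n) ℝ) : ℝ :=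
  sSup (spectrum ℝ A)

theorem isGreatest_lambdaMax {n : ℕ} (hn : 1 ≤ n) {A : Matrix (Fin n) (Fin n) ℝ}
    (hA : A.IsHermitian) : IsGreatest (spectrum ℝ A) (lambdaMax A) := by
  have : Nonempty (Fin n) := ⟨⟨0, hn⟩⟩
  have h := hA.spectrum_real_eq_range_eigenvalues
  have hne : (spectrum ℝ A).Nonempty := h ▸ Set.range_nonempty _
  have hfin : (spectrum ℝ A).Finite := h ▸ Set.finite_range _
  exact ⟨hne.csSup_mem hfin, fun _ hx => le_csSup hfin.bddAbove hx⟩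

/-- The random function `F_k(X) = max_{i ≤ k} λ_max (X + (ε / n) z_i z_iᵀ)` for given values
`z_1, …, z_k` of the random vectors. -/
def maxPerturbed {n k : ℕ} (ε : ℝ) (z : Fin k → EuclideanSpace ℝ (Fin n)) (X : SymMatrix n) : ℝ :=
  ⨆ i : Fin k, lambdaMax (symToMatrix X + (ε / n) • Matrix.vecMulVec (z i).ofLp (z i).ofLp)

/-- The stochastic smoothing `𝐄[max_{i ≤ k} λ_max (X + (ε / n) z_i z_iᵀ)]` of `λ_max`. -/
def smoothedLambdaMax {n k : ℕ} {Ω : Type*} [MeasurableSpace Ω] (μ : Measure Ω) (ε : ℝ)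
    (z : Fin k → Ω → EuclideanSpace ℝ (Fin n)) (X : SymMatrix n) : ℝ :=
  ∫ ω, maxPerturbed ε (fun i => z i ω) X ∂μ

end

/-! Put c = ε/n. The expectation F is convex and 1-Lipschitz, so it is enough to bound its symmetric
second differences from above: if F(X+τV) + F(X-τV) - 2F(X) ≤ (L‖V‖² + δ)τ² for all small τ, with L
= k/((k-2)c), then L‖X‖²/2 - F is convex too, and a continuous convex F with this property has an
L-Lipschitz gradient (`differentiable_and_lipschitz_gradient`).

Let T_i be the increase of λ_max caused by c z_i z_iᵀ, divided by c, and let S be the largest T_i.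
By interlacing, the top eigenvalue of the i-th perturbed matrix lies at least cT_i above the rest of
its spectrum, which controls the second order term of its expansion. If the same index is maximal at
X+τV and at X-τV, the first order terms cancel and about τ²‖V‖²/(cS) remains. If the indices differ,
the first order terms leave at most √2τ‖V‖, from which c times the gap between the two largest T_i
is subtracted; only samples with a gap of order τ contribute (`maxTopEig_second_difference_le`).

It remains to control the gap and 1/S in mean. In an eigenbasis of X, T_i is the root of the secular
equation ∑ y_j²/(t+L_j) = 1 with y standard Gaussian and some L_j = 0. Its density g is
nondecreasing relative to the chi-squared density with one degree of freedom
(`secularDensity_mul_le`), whence g(t) ≤ ∫_t^∞ (1/2 + 1/(2r)) g(r) dr. Conditioning on the other T_j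
gives E(a - gap)₊ ≤ (a²/2) E[1/2 + 1/(2S)] (`lintegral_gap_le`). Also T_i ≥ y_j² for an index j with
L_j = 0, so S dominates a maximum of k squared normals and E[1/S] ≤ κ = (k+2)/(3(k-2))
(`lintegral_inv_iSup_le`). With a = √2τ‖V‖/c the two contributions add up to (1/2 + κ/2 +
κ)τ²‖V‖²/c, and 1/2 + 3κ/2 = k/(k-2). -/

section

open Filter Topology Set

/-! ### Second differences and chords on the line. -/

/-- A continuous function on the line whose symmetric second differences are positive at every
point, at small scales, lies below its chord. -/
theorem le_chord_of_second_difference_pos {φ : ℝ → ℝ} (hφ : Continuous φ)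
    (h : ∀ x, ∀ᶠ τ in 𝓝[>] (0 : ℝ), 0 < φ (x + τ) + φ (x - τ) - 2 * φ x)
    {t : ℝ} (ht : t ∈ Icc (0 : ℝ) 1) : φ t ≤ (1 - t) * φ 0 + t * φ 1 := by
  -- The difference from the chord vanishes at both endpoints and has the same second differences as
  -- `φ`; at an interior maximum these could not be positive.
  set ψ : ℝ → ℝ := fun s => φ s - ((1 - s) * φ 0 + s * φ 1) with hψ
  have hψc : Continuous ψ := by fun_prop
  obtain ⟨s, hs, hmax⟩ := isCompact_Icc.exists_isMaxOn (⟨t, ht⟩ : (Icc (0 : ℝ) 1).Nonempty)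
    hψc.continuousOn
  have hle : ψ t ≤ ψ s := hmax ht
  have hs0 : ψ s ≤ 0 := by
    rcases hs.1.eq_or_lt with h0 | h0
    · simp [hψ, ← h0]
    rcases hs.2.eq_or_lt with h1 | h1
    · simp [hψ, h1]
    exfalso
    have e1 : ∀ᶠ τ in 𝓝[>] (0 : ℝ), τ < min s (1 - s) :=
      nhdsWithin_le_nhds (Iio_mem_nhds (by simp [h0, h1]))
    obtain ⟨τ, ⟨hτ1, hτ2⟩, hτ0⟩ := ((h s).and e1).and self_mem_nhdsWithin |>.exists
    have hτ0' : 0 < τ := hτ0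
    have l1 := lt_min_iff.mp hτ2
    have m1 : ψ (s + τ) ≤ ψ s := hmax ⟨by linarith, by linarith⟩
    have m2 : ψ (s - τ) ≤ ψ s := hmax ⟨by linarith, by linarith⟩
    simp only [hψ] at m1 m2
    nlinarith
  have : ψ t ≤ 0 := hle.trans hs0
  simp only [hψ] at this
  linarith

/-- A continuous function on the line whose lower second symmetric derivative is nonnegative lies
below its chord. -/
theorem le_chord_of_second_difference_nonneg {φ : ℝ → ℝ} (hφ : Continuous φ)
    (h : ∀ x, ∀ δ > (0 : ℝ), ∀ᶠ τ in 𝓝[>] (0 : ℝ),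
      -δ * τ ^ 2 ≤ φ (x + τ) + φ (x - τ) - 2 * φ x)
    {t : ℝ} (ht : t ∈ Icc (0 : ℝ) 1) : φ t ≤ (1 - t) * φ 0 + t * φ 1 := by
  -- Adding `η x²` contributes `2ητ²` to the second difference, which beats the defect `ητ²`. Then
  -- `η` tends to 0.
  have key : ∀ η > (0 : ℝ), φ t + η * t ^ 2 ≤ (1 - t) * φ 0 + t * φ 1 + η * t := by
    intro η hη
    have := le_chord_of_second_difference_pos (φ := fun x => φ x + η * x ^ 2) (by fun_prop)
      (fun x => by
        filter_upwards [h x η hη, self_mem_nhdsWithin] with τ hτ hτ0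
        have : 0 < τ := hτ0
        nlinarith [mul_pos hη (pow_pos this 2)]) ht
    nlinarith
  have lim : Tendsto (fun η : ℝ => (1 - t) * φ 0 + t * φ 1 + η * (t - t ^ 2)) (𝓝[>] 0)
      (𝓝 ((1 - t) * φ 0 + t * φ 1 + 0 * (t - t ^ 2))) :=
    ((by fun_prop : Continuous fun η : ℝ => (1 - t) * φ 0 + t * φ 1 + η * (t - t ^ 2)).tendsto
      0).mono_left nhdsWithin_le_nhds
  rw [zero_mul, add_zero] at lim
  refine ge_of_tendsto lim ?_
  filter_upwards [self_mem_nhdsWithin] with η hη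
  linarith [key η hη]

/-! ### Convex functions on a Hilbert space with Lipschitz gradient. -/

section ConvexSmooth

variable {E : Type*} [NormedAddCommGroup E] [InnerProductSpace ℝ E]

/-- On the line through `x` and `y`, the quadratic `L/2 ‖·‖²` has second difference exactly `L‖y -
x‖²τ²`, so subtracting `f` leaves at least `-δτ²` and the one-variable chord criterion applies. -/
theorem convexOn_half_mul_norm_sq_sub {f : E → ℝ} (hf : Continuous f) {L : ℝ}
    (h : ∀ x v : E, ∀ δ > (0 : ℝ), ∀ᶠ τ in 𝓝[>] (0 : ℝ),
      f (x + τ • v) + f (x - τ • v) - 2 * f x ≤ (L * ‖v‖ ^ 2 + δ) * τ ^ 2) :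
    ConvexOn ℝ univ (fun x => L / 2 * ‖x‖ ^ 2 - f x) := by
  refine ⟨convex_univ, fun x _ y _ a b ha hb hab => ?_⟩
  have hnorm : ∀ (p v : E) (s : ℝ),
      ‖p + s • v‖ ^ 2 = ‖p‖ ^ 2 + 2 * s * inner ℝ p v + s ^ 2 * ‖v‖ ^ 2 := by
    intro p v s
    rw [norm_add_sq_real, inner_smul_right, norm_smul, mul_pow, Real.norm_eq_abs, sq_abs]
    ring
  have := le_chord_of_second_difference_nonneg
    (φ := fun t : ℝ => L / 2 * ‖x + t • (y - x)‖ ^ 2 - f (x + t • (y - x))) (by fun_prop)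
    (fun t δ hδ => by
      filter_upwards [h (x + t • (y - x)) (y - x) δ hδ] with τ hτ
      have e1 : x + (t + τ) • (y - x) = (x + t • (y - x)) + τ • (y - x) := by module
      have e2 : x + (t - τ) • (y - x) = (x + t • (y - x)) + (-τ) • (y - x) := by module
      have e3 : (x + t • (y - x)) - τ • (y - x) = (x + t • (y - x)) + (-τ) • (y - x) := by module
      rw [e3] at hτ
      rw [e1, e2, hnorm (x + t • (y - x)), hnorm (x + t • (y - x))]
      nlinarith) (t := b) ⟨hb, by linarith⟩
  have ea : a = 1 - b := by linarith
  have e4 : a • x + b • y = x + b • (y - x) := by rw [ea]; module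
  simp only [e4, smul_eq_mul]
  simpa [ea] using this

/-- Co-coercivity: a convex function with the two-sided quadratic estimate has a Lipschitz
gradient. -/
theorem norm_sub_le_of_quadratic_estimate {f : E → ℝ} {L : ℝ} (hL : 0 < L) {G : E → E}
    (h : ∀ x y, f x + inner ℝ (G x) (y - x) ≤ f y ∧
      f y ≤ f x + inner ℝ (G x) (y - x) + L / 2 * ‖y - x‖ ^ 2) (x y : E) :
    ‖G x - G y‖ ≤ L * ‖x - y‖ := by
  have key : ∀ x y, f x + inner ℝ (G x) (y - x) + 1 / (2 * L) * ‖G y - G x‖ ^ 2 ≤ f y := by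
    intro x y
    set d := G y - G x with hd
    -- The test point is the minimiser of the quadratic upper model at `y` after subtraction of the
    -- linear function with slope `G x`. Comparing both models there produces the extra term in
    -- `key`.
    have h1 := (h x (y - L⁻¹ • d)).1
    have h2 := (h y (y - L⁻¹ • d)).2
    have e1 : y - L⁻¹ • d - x = (y - x) - L⁻¹ • d := by abel
    have e2 : y - L⁻¹ • d - y = -(L⁻¹ • d) := by abel
    rw [e1, inner_sub_right, inner_smul_right] at h1
    rw [e2, inner_neg_right, inner_smul_right, norm_neg, norm_smul, mul_pow, Real.norm_eq_abs,
      sq_abs] at h2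
    have e3 : inner ℝ (G y) d - inner ℝ (G x) d = ‖d‖ ^ 2 := by
      rw [← inner_sub_left, real_inner_self_eq_norm_sq]
    have e4 : L / 2 * (L⁻¹ ^ 2 * ‖d‖ ^ 2) = 1 / 2 * L⁻¹ * ‖d‖ ^ 2 := by
      field_simp
    have e5 : 1 / (2 * L) * ‖d‖ ^ 2 = 1 / 2 * L⁻¹ * ‖d‖ ^ 2 := by field_simp
    rw [e4] at h2
    rw [e5]
    have e6 : L⁻¹ * inner ℝ (G y) d - L⁻¹ * inner ℝ (G x) d = L⁻¹ * ‖d‖ ^ 2 := by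
      rw [← e3]; ring
    linarith
  have h1 := key x y
  have h2 := key y x
  have e1 : inner ℝ (G x) (y - x) = - inner ℝ (G x) (x - y) := by
    rw [← inner_neg_right, neg_sub]
  rw [e1] at h1
  rw [norm_sub_rev (G y) (G x)] at h1
  have h3 : 1 / L * ‖G x - G y‖ ^ 2 ≤ inner ℝ (G x - G y) (x - y) := by
    rw [inner_sub_left]
    have : 1 / L = 1 / (2 * L) + 1 / (2 * L) := by field_simp; norm_num
    rw [this, add_mul]
    linarith
  have h4 := h3.trans (real_inner_le_norm _ _)
  rcases (norm_nonneg (G x - G y)).eq_or_lt with h0 | h0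
  · rw [← h0]; positivity
  · rw [one_div, inv_mul_le_iff₀ hL] at h4
    have : ‖G x - G y‖ * ‖G x - G y‖ ≤ ‖G x - G y‖ * (L * ‖x - y‖) := by nlinarith
    exact le_of_mul_le_mul_left this h0

variable [CompleteSpace E]

/-- A continuous convex function on a Hilbert space has a subgradient at every point. -/
theorem ConvexOn.exists_subgradient {f : E → ℝ} (hf : Continuous f)
    (hconv : ConvexOn ℝ univ f) (x : E) : ∃ p : E, ∀ y, f x + inner ℝ p (y - x) ≤ f y := by
  have hopen : IsOpen {q : E × ℝ | f q.1 < q.2} :=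
    isOpen_lt (hf.comp continuous_fst) continuous_snd
  have hcs : Convex ℝ {q : E × ℝ | f q.1 < q.2} := by
    have := hconv.convex_strict_epigraph
    simpa using this
  -- Separate the point `(x, f x)` from the open strict epigraph. The functional is negative on the
  -- vertical direction, since the points above `(x, f x)` lie in the epigraph, so it can be
  -- normalised into a slope.
  obtain ⟨l, hl⟩ := geometric_hahn_banach_open_point hcs hopen
    (x := (x, f x)) (by simp)
  have hsplit : ∀ (y : E) (r : ℝ), l (y, r) = l (y, 0) + r * l (0, 1) := by
    intro y r
    have : ((y, r) : E × ℝ) = (y, 0) + r • ((0 : E), (1 : ℝ)) := by simp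
    rw [this, map_add, map_smul, smul_eq_mul]
  have hneg : l (0, 1) < 0 := by
    have := hl (x, f x + 1) (by simp)
    rw [hsplit, hsplit x (f x)] at this
    linarith
  set c := -l (0, 1) with hc
  have hc0 : 0 < c := by simpa [hc] using hneg
  let l' : StrongDual ℝ E := c⁻¹ • (l.comp (ContinuousLinearMap.inl ℝ E ℝ))
  refine ⟨(InnerProductSpace.toDual ℝ E).symm l', fun y => ?_⟩
  rw [InnerProductSpace.toDual_symm_apply]
  have e : l' (y - x) = c⁻¹ * (l (y, 0) - l (x, 0)) := by
    simp [l', ← map_sub]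
  rw [e]
  refine le_of_forall_pos_lt_add fun ε hε => ?_
  have := hl (y, f y + ε) (by simp [hε])
  rw [hsplit, hsplit x (f x)] at this
  have h2 : l (y, 0) - l (x, 0) < c * (f y + ε - f x) := by
    have : l (0, 1) = -c := by simp [hc]
    rw [this] at *
    linarith
  have := mul_lt_mul_of_pos_left h2 (inv_pos.mpr hc0)
  rw [inv_mul_cancel_left₀ hc0.ne'] at this
  linarith

/-- A convex function `f` such that `L / 2 * ‖x‖ ^ 2 - f x` is convex has a gradient satisfying the
two-sided quadratic estimate. -/
theorem ConvexOn.exists_gradient_of_convexOn_sub {f : E → ℝ} (hf : Continuous f)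
    (hconv : ConvexOn ℝ univ f) {L : ℝ} 
    (hL : ConvexOn ℝ univ (fun x => L / 2 * ‖x‖ ^ 2 - f x)) (x : E) :
    ∃ p : E, ∀ y, f x + inner ℝ p (y - x) ≤ f y ∧
      f y ≤ f x + inner ℝ p (y - x) + L / 2 * ‖y - x‖ ^ 2 := by
  obtain ⟨p, hp⟩ := hconv.exists_subgradient hf x
  obtain ⟨q, hq⟩ := hL.exists_subgradient (by fun_prop) x
  have hq' : ∀ v : E, f (x + v) ≤ f x + inner ℝ (L • x - q) v + L / 2 * ‖v‖ ^ 2 := by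
    intro v
    have := hq (x + v)
    simp only [add_sub_cancel_left] at this
    rw [norm_add_sq_real] at this
    rw [inner_sub_left, inner_smul_left]
    simp only [conj_trivial]
    linarith
  have hp' : ∀ v : E, f x + inner ℝ p v ≤ f (x + v) := by
    intro v; simpa using hp (x + v)
  -- `p` is a slope from below and `L • x - q` a slope from above, up to a quadratic error. Moving
  -- by `s` along their difference sets a linear term against a quadratic one, so the slopes agree.
  have hd : ∀ (s : ℝ), s * ‖p - (L • x - q)‖ ^ 2 ≤ L / 2 * s ^ 2 * ‖p - (L • x - q)‖ ^ 2 := by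
    intro s
    have h1 := (hp' (s • (p - (L • x - q)))).trans (hq' _)
    rw [inner_smul_right, inner_smul_right, norm_smul, mul_pow, Real.norm_eq_abs, sq_abs] at h1
    have h2 : inner ℝ p (p - (L • x - q)) - inner ℝ (L • x - q) (p - (L • x - q))
        = ‖p - (L • x - q)‖ ^ 2 := by
      rw [← inner_sub_left, real_inner_self_eq_norm_sq]
    have h3 := congrArg (s * ·) h2
    simp only [mul_sub] at h3
    linarith
  have hpq : p = L • x - q := by
    by_contra hne
    have hpos : 0 < ‖p - (L • x - q)‖ ^ 2 := by
      have := norm_pos_iff.mpr (sub_ne_zero.mpr hne)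
      positivity
    have h1 := hd (1 / (|L| + 1))
    have h2 : 1 / (|L| + 1) ≤ L / 2 * (1 / (|L| + 1)) ^ 2 := by
      by_contra h3
      push Not at h3
      nlinarith
    have h3 : 0 < |L| + 1 := by positivity
    have h4 : L ≤ |L| := le_abs_self L
    rw [div_pow, one_pow, mul_one_div, div_le_div_iff₀ h3 (by positivity)] at h2
    nlinarith [abs_nonneg L]
  refine ⟨p, fun y => ⟨hp y, ?_⟩⟩
  have := hq' (y - x)
  rw [← hpq] at this
  simpa using this

theorem hasGradientAt_of_quadratic_estimate {f : E → ℝ} {L : ℝ} {x p : E}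
    (h : ∀ y, f x + inner ℝ p (y - x) ≤ f y ∧
      f y ≤ f x + inner ℝ p (y - x) + L / 2 * ‖y - x‖ ^ 2) : HasGradientAt f p x := by
  rw [hasGradientAt_iff_isLittleO]
  have hO : (fun y => f y - f x - inner ℝ p (y - x)) =O[𝓝 x] fun y => ‖y - x‖ ^ 2 := by
    refine Asymptotics.IsBigO.of_bound (|L / 2|) (Eventually.of_forall fun y => ?_)
    have hy := h y
    rw [Real.norm_eq_abs, Real.norm_eq_abs, abs_of_nonneg (by linarith [hy.1]),
      abs_of_nonneg (sq_nonneg ‖y - x‖)]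
    have := mul_le_mul_of_nonneg_right (le_abs_self (L / 2)) (by positivity : 0 ≤ ‖y - x‖ ^ 2)
    linarith [hy.2]
  refine hO.trans_isLittleO ?_
  have h1 : Tendsto (fun y => y - x) (𝓝 x) (𝓝 0) := by
    have : Continuous fun y => y - x := by fun_prop
    simpa using this.tendsto x
  exact (Asymptotics.isLittleO_norm_pow_id one_lt_two).comp_tendsto h1 

/-- The range of admissible `τ` may depend on the point, the direction and `δ`. A limit of second
difference quotients at each fixed point and direction is therefore enough, with no uniformity. -/
theorem differentiable_and_lipschitz_gradient {f : E → ℝ} (hf : Continuous f)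
    (hconv : ConvexOn ℝ univ f) {L : ℝ} (hL : 0 < L)
    (h : ∀ x v : E, ∀ δ > (0 : ℝ), ∀ᶠ τ in 𝓝[>] (0 : ℝ),
      f (x + τ • v) + f (x - τ • v) - 2 * f x ≤ (L * ‖v‖ ^ 2 + δ) * τ ^ 2) :
    Differentiable ℝ f ∧ ∀ x y, ‖gradient f x - gradient f y‖ ≤ L * ‖x - y‖ := by
  choose G hG using hconv.exists_gradient_of_convexOn_sub hf (convexOn_half_mul_norm_sq_sub hf h)
  have hgrad : ∀ x, HasGradientAt f (G x) x := fun x => hasGradientAt_of_quadratic_estimate (hG x)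
  refine ⟨fun x => (hgrad x).differentiableAt, fun x y => ?_⟩
  rw [(hgrad x).gradient, (hgrad y).gradient]
  exact norm_sub_le_of_quadratic_estimate hL hG x y

end ConvexSmooth

/-! ### The half-normal law and the inverse moment of a maximum. -/

noncomputable section HalfNormal

/-- The density of the absolute value of a standard normal variable. -/
def halfNormalPDF (x : ℝ) : ℝ := 2 * gaussianPDFReal 0 1 x

/-- The distribution function of the absolute value of a standard normal variable. -/
def halfNormalCDF (x : ℝ) : ℝ := ∫ t in (0 : ℝ)..x, halfNormalPDF t

theorem halfNormalPDF_eq (x : ℝ) :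
    halfNormalPDF x = 2 * (√(2 * Real.pi))⁻¹ * Real.exp (-x ^ 2 / 2) := by
  simp [halfNormalPDF, gaussianPDFReal, mul_assoc]

theorem halfNormalPDF_nonneg (x : ℝ) : 0 ≤ halfNormalPDF x := by
  rw [halfNormalPDF_eq]; positivity

theorem hasDerivAt_halfNormalPDF (x : ℝ) :
    HasDerivAt halfNormalPDF (-x * halfNormalPDF x) x := by
  have h1 : HasDerivAt (fun x : ℝ => -x ^ 2 / 2) (-x) x := by
    have := ((hasDerivAt_pow 2 x).neg).div_const 2
    refine HasDerivAt.congr_deriv this ?_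
    simp; ring
  have h2 := (h1.exp).const_mul (2 * (√(2 * Real.pi))⁻¹)
  have e : halfNormalPDF = fun x => 2 * (√(2 * Real.pi))⁻¹ * Real.exp (-x ^ 2 / 2) :=
    funext halfNormalPDF_eq
  rw [e]
  refine HasDerivAt.congr_deriv h2 ?_
  ring

theorem continuous_halfNormalPDF : Continuous halfNormalPDF :=
  continuous_iff_continuousAt.mpr fun x => (hasDerivAt_halfNormalPDF x).continuousAt

theorem halfNormalPDF_le_one (x : ℝ) : halfNormalPDF x ≤ 1 := by
  rw [halfNormalPDF_eq]
  have h1 : Real.exp (-x ^ 2 / 2) ≤ 1 := Real.exp_le_one_iff.mpr (by nlinarith [sq_nonneg x])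
  have h2 : 2 ≤ √(2 * Real.pi) := Real.le_sqrt_of_sq_le (by nlinarith [Real.pi_gt_three])
  have h3 : 2 * (√(2 * Real.pi))⁻¹ ≤ 1 := by
    rw [← div_eq_mul_inv, div_le_one (by linarith)]; exact h2
  exact mul_le_one₀ h3 (Real.exp_pos _).le h1

theorem hasDerivAt_halfNormalCDF (x : ℝ) : HasDerivAt halfNormalCDF (halfNormalPDF x) x :=
  intervalIntegral.integral_hasDerivAt_right
    (continuous_halfNormalPDF.intervalIntegrable (μ := volume) _ _)
    (continuous_halfNormalPDF.stronglyMeasurableAtFilter _ _)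
    continuous_halfNormalPDF.continuousAt

@[simp] theorem halfNormalCDF_zero : halfNormalCDF 0 = 0 := by simp [halfNormalCDF]

theorem halfNormalCDF_nonneg {x : ℝ} (hx : 0 ≤ x) : 0 ≤ halfNormalCDF x :=
  intervalIntegral.integral_nonneg hx fun t _ => halfNormalPDF_nonneg t

theorem halfNormalCDF_le_self {x : ℝ} (hx : 0 ≤ x) : halfNormalCDF x ≤ x := by
  have := intervalIntegral.integral_mono_on (μ := volume) hx (continuous_halfNormalPDF.intervalIntegrable 0 x)
    (intervalIntegrable_const (c := (1 : ℝ))) fun t _ => halfNormalPDF_le_one t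
  simpa [halfNormalCDF] using this

theorem gaussianReal_Icc_neg_self {x : ℝ} (hx : 0 ≤ x) :
    gaussianReal 0 1 (Icc (-x) x) = ENNReal.ofReal (halfNormalCDF x) := by
  rw [gaussianReal_apply_eq_integral _ (by norm_num), integral_Icc_eq_integral_Ioc,
    ← intervalIntegral.integral_of_le (by linarith)]
  congr 1
  have hc : Continuous (gaussianPDFReal 0 1) := by
    unfold gaussianPDFReal; fun_prop
  have hsymm : ∀ t : ℝ, gaussianPDFReal 0 1 (-t) = gaussianPDFReal 0 1 t := by
    intro t; simp [gaussianPDFReal]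
  rw [← intervalIntegral.integral_add_adjacent_intervals (b := 0) (hc.intervalIntegrable _ _)
    (hc.intervalIntegrable _ _), halfNormalCDF]
  simp only [halfNormalPDF, intervalIntegral.integral_const_mul]
  have := intervalIntegral.integral_comp_neg (a := 0) (b := x) (gaussianPDFReal 0 1)
  simp only [hsymm, neg_zero] at this
  rw [← this]
  ring

theorem tendsto_halfNormalPDF_atTop : Tendsto halfNormalPDF atTop (𝓝 0) := by
  have h : Tendsto (fun x : ℝ => -x ^ 2 / 2) atTop atBot := by
    have h1 : Tendsto (fun x : ℝ => x ^ 2 / 2) atTop atTop :=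
      (tendsto_pow_atTop two_ne_zero).atTop_div_const two_pos
    refine (tendsto_neg_atTop_atBot.comp h1).congr fun x => ?_
    simp [neg_div]
  have e : halfNormalPDF = fun x => 2 * (√(2 * Real.pi))⁻¹ * Real.exp (-x ^ 2 / 2) :=
    funext halfNormalPDF_eq
  rw [e]
  simpa using (Real.tendsto_exp_atBot.comp h).const_mul (2 * (√(2 * Real.pi))⁻¹)

theorem tendsto_halfNormalCDF_atTop : Tendsto halfNormalCDF atTop (𝓝 1) := by
  have h1 : Tendsto (fun x : ℝ => gaussianReal 0 1 (Icc (-x) x)) atTop (𝓝 1) := by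
    have := tendsto_measure_iUnion_atTop (μ := gaussianReal 0 1)
      (s := fun x : ℝ => Icc (-x) x) (fun a b hab => Icc_subset_Icc (neg_le_neg hab) hab)
    have hu : ⋃ x : ℝ, Icc (-x) x = univ :=
      eq_univ_of_forall fun t => mem_iUnion.mpr ⟨|t|, neg_abs_le t, le_abs_self t⟩
    rwa [hu, measure_univ] at this
  have h2 := (ENNReal.tendsto_toReal ENNReal.one_ne_top).comp h1
  refine Tendsto.congr' ?_ h2
  filter_upwards [eventually_ge_atTop 0] with x hx
  simp [gaussianReal_Icc_neg_self hx, halfNormalCDF_nonneg hx]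

/-- By integration by parts the difference is the truncated second moment, the integral of `t²`
against the density over `[0, x]`. -/
theorem mul_halfNormalPDF_le_halfNormalCDF {x : ℝ} (hx : 0 ≤ x) :
    x * halfNormalPDF x ≤ halfNormalCDF x := by
  have hd : ∀ x, HasDerivAt (fun x => halfNormalCDF x - x * halfNormalPDF x)
      (x ^ 2 * halfNormalPDF x) x := by
    intro x
    have := (hasDerivAt_halfNormalCDF x).sub ((hasDerivAt_id x).mul (hasDerivAt_halfNormalPDF x))
    refine HasDerivAt.congr_deriv this ?_
    simp; ring
  have hm : MonotoneOn (fun x => halfNormalCDF x - x * halfNormalPDF x) (Ici 0) :=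
    monotoneOn_of_deriv_nonneg (convex_Ici 0)
      (fun x _ => (hd x).continuousAt.continuousWithinAt)
      (fun x _ => (hd x).differentiableAt.differentiableWithinAt)
      (fun x _ => by
        rw [(hd x).deriv]; exact mul_nonneg (sq_nonneg x) (halfNormalPDF_nonneg x))
  have := hm self_mem_Ici hx hx
  simp at this
  linarith

/-- The second moment of the half-normal law truncated at `x` is at most that of the uniform law on
`[0, x]`, after an integration by parts. -/
theorem one_sub_mul_halfNormalCDF_le {x : ℝ} (hx : 0 ≤ x) :
    (1 - x ^ 2 / 3) * halfNormalCDF x ≤ x * halfNormalPDF x := by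
  have hd : ∀ x, HasDerivAt (fun x => x * halfNormalPDF x - (1 - x ^ 2 / 3) * halfNormalCDF x)
      (2 * x / 3 * (halfNormalCDF x - x * halfNormalPDF x)) x := by
    intro x
    have h1 : HasDerivAt (fun x : ℝ => 1 - x ^ 2 / 3) (-(2 * x / 3)) x := by
      have := ((hasDerivAt_pow 2 x).div_const 3).const_sub 1
      refine HasDerivAt.congr_deriv this ?_
      simp
    have := ((hasDerivAt_id x).mul (hasDerivAt_halfNormalPDF x)).sub
      (h1.mul (hasDerivAt_halfNormalCDF x))
    refine HasDerivAt.congr_deriv this ?_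
    simp; ring
  have hm : MonotoneOn (fun x => x * halfNormalPDF x - (1 - x ^ 2 / 3) * halfNormalCDF x)
      (Ici 0) :=
    monotoneOn_of_deriv_nonneg (convex_Ici 0)
      (fun x _ => (hd x).continuousAt.continuousWithinAt)
      (fun x _ => (hd x).differentiableAt.differentiableWithinAt)
      (fun x hx => by
        rw [interior_Ici] at hx
        have hx0 : 0 < x := hx
        rw [(hd x).deriv]
        exact mul_nonneg (by positivity)
          (sub_nonneg.mpr (mul_halfNormalPDF_le_halfNormalCDF hx0.le)))
  have := hm self_mem_Ici hx hx
  simp at this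
  linarith

/-- An explicit `Ψ` vanishes at 0, tends to `(k+2)/3` at infinity, and has derivative at least `k -
2` times the integrand. Its first two terms come from integrating `x⁻³ E^k` by parts; the last one,
a multiple of `E^k`, pays for the error in `one_sub_mul_halfNormalCDF_le`. -/
theorem lintegral_halfNormalCDF_pow_le (k : ℕ) (hk : 3 ≤ k) :
    ∫⁻ x in Ioi (0 : ℝ), ENNReal.ofReal (2 * (x ^ 3)⁻¹ * halfNormalCDF x ^ k) ≤
      ENNReal.ofReal (((k : ℝ) + 2) / (3 * ((k : ℝ) - 2))) := by
  -- With `k = m + 3`, the coefficients `m + 3`, `m + 1` and `m + 5` are `k`, `k - 2` and `k + 2`.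
  obtain ⟨m, rfl⟩ := Nat.exists_eq_add_of_le' hk
  set E := halfNormalCDF with hE
  set e := halfNormalPDF with he
  set Ψ : ℝ → ℝ := fun x => (m + 3) * (x⁻¹ * (E x ^ (m + 2) * e x))
    - (m + 1) * (x⁻¹ ^ 2 * E x ^ (m + 3)) + (m + 5) / 3 * E x ^ (m + 3) with hΨ
  set Ψ' : ℝ → ℝ := fun x =>
    (m + 3) * (-(x ^ 2)⁻¹ * (E x ^ (m + 2) * e x)
      + x⁻¹ * ((m + 2) * E x ^ (m + 1) * e x * e x + E x ^ (m + 2) * (-x * e x)))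
    - (m + 1) * (2 * x⁻¹ * (-(x ^ 2)⁻¹) * E x ^ (m + 3)
      + x⁻¹ ^ 2 * ((m + 3) * E x ^ (m + 2) * e x))
    + (m + 5) / 3 * ((m + 3) * E x ^ (m + 2) * e x) with hΨ'
  have hderiv : ∀ x ∈ Ioi (0 : ℝ), HasDerivAt Ψ (Ψ' x) x := by
    intro x hx
    have hx0 : x ≠ 0 := (mem_Ioi.mp hx).ne'
    have hi := hasDerivAt_inv hx0
    have hEd := hasDerivAt_halfNormalCDF x
    have hed := hasDerivAt_halfNormalPDF x
    have h1 := (hi.mul ((hEd.pow (m + 2)).mul hed)).const_mul ((m : ℝ) + 3)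
    have h2 := ((hi.pow 2).mul (hEd.pow (m + 3))).const_mul ((m : ℝ) + 1)
    have h3 := (hEd.pow (m + 3)).const_mul (((m : ℝ) + 5) / 3)
    refine HasDerivAt.congr_deriv ((h1.sub h2).add h3) ?_
    simp [hΨ']
    ring
  have hbound : ∀ x ∈ Ioi (0 : ℝ), (m + 1) * (2 * (x ^ 3)⁻¹ * E x ^ (m + 3)) ≤ Ψ' x := by
    intro x hx
    have hx0 : 0 < x := hx
    have hE0 : 0 ≤ E x := halfNormalCDF_nonneg hx0.le
    have he0 : 0 ≤ e x := halfNormalPDF_nonneg x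
    have key := one_sub_mul_halfNormalCDF_le hx0.le
    have hfac : Ψ' x - (m + 1) * (2 * (x ^ 3)⁻¹ * E x ^ (m + 3)) =
        (m + 3) * (m + 2) * (x ^ 2)⁻¹ * E x ^ (m + 1) * e x
          * (x * e x - (1 - x ^ 2 / 3) * E x) := by
      simp only [hΨ']
      field_simp
      ring
    have : 0 ≤ Ψ' x - (m + 1) * (2 * (x ^ 3)⁻¹ * E x ^ (m + 3)) := by
      rw [hfac]
      exact mul_nonneg (by positivity) (sub_nonneg.mpr key)
    linarith
  have hpos : ∀ x ∈ Ioi (0 : ℝ), 0 ≤ Ψ' x := by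
    intro x hx
    have hx0 : 0 < x := hx
    have hE0 : 0 ≤ E x := halfNormalCDF_nonneg hx0.le
    exact le_trans (by positivity) (hbound x hx)
  have hΨ0 : Ψ 0 = 0 := by simp [hΨ, hE]
  -- Since `E x ≤ x` and `e x ≤ 1`, the singular terms are of order `x ^ (k - 2)`, which tends to 0
  -- because `k ≥ 3`.
  have hcont : ContinuousWithinAt Ψ (Ici 0) 0 := by
    unfold ContinuousWithinAt
    rw [hΨ0, tendsto_iff_norm_sub_tendsto_zero]
    have hlim : Tendsto (fun x : ℝ => ((m : ℝ) + 3) * x ^ (m + 1) + (m + 1) * x ^ (m + 1)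
        + (m + 5) / 3 * x ^ (m + 3)) (𝓝[≥] 0) (𝓝 0) := by
      have : Continuous (fun x : ℝ => ((m : ℝ) + 3) * x ^ (m + 1) + (m + 1) * x ^ (m + 1)
        + (m + 5) / 3 * x ^ (m + 3)) := by fun_prop
      have := (this.tendsto 0).mono_left (nhdsWithin_le_nhds (s := Ici (0 : ℝ)))
      simpa using this
    refine squeeze_zero' (Eventually.of_forall fun _ => norm_nonneg _) ?_ hlim
    filter_upwards [self_mem_nhdsWithin] with x hx
    have hx0 : 0 ≤ x := hx
    rcases hx0.eq_or_lt with h | h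
    · simp [← h, hΨ0]
    have hE0 : 0 ≤ E x := halfNormalCDF_nonneg hx0
    have hEx : E x ≤ x := halfNormalCDF_le_self hx0
    have he0 : 0 ≤ e x := halfNormalPDF_nonneg x
    have he1 : e x ≤ 1 := halfNormalPDF_le_one x
    have b1 : x⁻¹ * (E x ^ (m + 2) * e x) ≤ x ^ (m + 1) := by
      rw [inv_mul_le_iff₀ h]
      calc E x ^ (m + 2) * e x ≤ x ^ (m + 2) * 1 := by gcongr
        _ = x * x ^ (m + 1) := by ring
    have b2 : x⁻¹ ^ 2 * E x ^ (m + 3) ≤ x ^ (m + 1) := by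
      rw [inv_pow, inv_mul_le_iff₀ (by positivity)]
      calc E x ^ (m + 3) ≤ x ^ (m + 3) := by gcongr
        _ = x ^ 2 * x ^ (m + 1) := by ring
    have b3 : E x ^ (m + 3) ≤ x ^ (m + 3) := by gcongr
    have p1 : 0 ≤ x⁻¹ * (E x ^ (m + 2) * e x) := by positivity
    have p2 : 0 ≤ x⁻¹ ^ 2 * E x ^ (m + 3) := by positivity
    have p3 : 0 ≤ E x ^ (m + 3) := by positivity
    have c1 := mul_le_mul_of_nonneg_left b1 (by positivity : (0 : ℝ) ≤ m + 3)
    have c2 := mul_le_mul_of_nonneg_left b2 (by positivity : (0 : ℝ) ≤ m + 1)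
    have c3 := mul_le_mul_of_nonneg_left b3 (by positivity : (0 : ℝ) ≤ (m + 5) / 3)
    have d1 := mul_nonneg (by positivity : (0 : ℝ) ≤ m + 3) p1
    have d2 := mul_nonneg (by positivity : (0 : ℝ) ≤ m + 1) p2
    have d3 := mul_nonneg (by positivity : (0 : ℝ) ≤ (m + 5) / 3) p3
    rw [Real.norm_eq_abs, abs_le]
    simp only [hΨ, sub_zero]
    constructor <;> linarith
  have hlim : Tendsto Ψ atTop (𝓝 ((m + 5) / 3)) := by
    have hi := tendsto_inv_atTop_zero (𝕜 := ℝ)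
    have h1 := (hi.mul ((tendsto_halfNormalCDF_atTop.pow (m + 2)).mul
      tendsto_halfNormalPDF_atTop)).const_mul ((m : ℝ) + 3)
    have h2 := ((hi.pow 2).mul (tendsto_halfNormalCDF_atTop.pow (m + 3))).const_mul ((m : ℝ) + 1)
    have h3 := (tendsto_halfNormalCDF_atTop.pow (m + 3)).const_mul (((m : ℝ) + 5) / 3)
    simpa [hΨ] using (h1.sub h2).add h3
  have hint := integral_Ioi_of_hasDerivAt_of_nonneg hcont hderiv hpos hlim
  have hintble := integrableOn_Ioi_deriv_of_nonneg hcont hderiv hpos hlim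
  rw [hΨ0, sub_zero] at hint
  have hm1 : (0 : ℝ) < m + 1 := by positivity
  calc ∫⁻ x in Ioi (0 : ℝ), ENNReal.ofReal (2 * (x ^ 3)⁻¹ * E x ^ (m + 3))
      ≤ ∫⁻ x in Ioi (0 : ℝ), ENNReal.ofReal ((m + 1 : ℝ)⁻¹ * Ψ' x) := by
        refine setLIntegral_mono' measurableSet_Ioi fun x hx => ENNReal.ofReal_le_ofReal ?_
        rw [le_inv_mul_iff₀ hm1]
        exact hbound x hx
    _ = ENNReal.ofReal (∫ x in Ioi (0 : ℝ), (m + 1 : ℝ)⁻¹ * Ψ' x) := by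
        rw [ofReal_integral_eq_lintegral_ofReal (hintble.const_mul _)]
        exact (ae_restrict_mem measurableSet_Ioi).mono fun x hx =>
          mul_nonneg (by positivity) (hpos x hx)
    _ = _ := by
        rw [integral_const_mul, hint]
        congr 1
        push_cast
        have h1 : (m : ℝ) + 3 - 2 = m + 1 := by ring
        have h2 : (m : ℝ) + 3 + 2 = m + 5 := by ring
        rw [h1, h2]
        field_simp

/-- The mean of the inverse of a nonnegative variable that dominates the maximum of `k` squares of
independent standard normal variables. -/
theorem lintegral_inv_le_of_measure_le {Ω : Type*} [MeasurableSpace Ω] {μ : Measure Ω} [SFinite μ]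
    {k : ℕ} (hk : 3 ≤ k) {S : Ω → ℝ} (hS : AEMeasurable S μ)
    (h : ∀ x > (0 : ℝ), μ {ω | S ω ≤ x ^ 2} ≤ ENNReal.ofReal (halfNormalCDF x ^ k)) :
    ∫⁻ ω, ENNReal.ofReal (S ω)⁻¹ ∂μ ≤ ENNReal.ofReal (((k : ℝ) + 2) / (3 * ((k : ℝ) - 2))) := by
  wlog hSm : Measurable S generalizing S
  · have hmk : ∀ᵐ ω ∂μ, S ω = hS.mk S ω := hS.ae_eq_mk
    have := this (S := hS.mk S) hS.measurable_mk.aemeasurable (fun x hx => by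
      refine le_trans (le_of_eq ?_) (h x hx)
      refine measure_congr ?_
      filter_upwards [hmk] with ω hω
      exact propext (by change hS.mk S ω ≤ x ^ 2 ↔ S ω ≤ x ^ 2; rw [hω])) hS.measurable_mk
    refine le_trans (le_of_eq (lintegral_congr_ae ?_)) this
    filter_upwards [hmk] with ω hω
    rw [hω]
  refine le_trans ?_ (lintegral_halfNormalCDF_pow_le k hk)
  -- Layer-cake formula: for `s > 0`, `1/s` is the integral of `2x⁻³` over `x > √s`. Tonelli then
  -- brings in the distribution function of `S`.
  have hcalc : ∀ s : ℝ, ENNReal.ofReal s⁻¹ ≤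
      ∫⁻ x in Ioi (0 : ℝ), {x : ℝ | s ≤ x ^ 2}.indicator
        (fun x => ENNReal.ofReal (2 * (x ^ 3)⁻¹)) x := by
    intro s
    rcases le_or_gt s 0 with hs | hs
    · rw [ENNReal.ofReal_of_nonpos (inv_nonpos.mpr hs)]; exact zero_le
    have hsq : 0 < √s := Real.sqrt_pos.mpr hs
    have hd : ∀ x ∈ Ici (√s), HasDerivAt (fun x : ℝ => -(x ^ 2)⁻¹) (2 * (x ^ 3)⁻¹) x := by
      intro x hx
      have hx0 : 0 < x := hsq.trans_le hx
      have := ((hasDerivAt_pow 2 x).inv (by positivity)).neg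
      refine HasDerivAt.congr_deriv this ?_
      field_simp
      norm_num
      ring
    have hp : ∀ x ∈ Ioi (√s), 0 ≤ 2 * (x ^ 3)⁻¹ := by
      intro x hx
      have hx0 : 0 < x := hsq.trans hx
      positivity
    have hl : Tendsto (fun x : ℝ => -(x ^ 2)⁻¹) atTop (𝓝 0) := by
      have := (tendsto_inv_atTop_zero.comp (tendsto_pow_atTop (α := ℝ) two_ne_zero)).neg
      simpa using this
    have h1 := integral_Ioi_of_hasDerivAt_of_nonneg' hd hp hl
    have h2 := integrableOn_Ioi_deriv_of_nonneg' hd hp hl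
    rw [Real.sq_sqrt hs.le, zero_sub, neg_neg] at h1
    rw [← h1, ofReal_integral_eq_lintegral_ofReal h2
      ((ae_restrict_mem measurableSet_Ioi).mono fun x hx => hp x hx)]
    rw [← lintegral_indicator measurableSet_Ioi, ← lintegral_indicator measurableSet_Ioi]
    refine lintegral_mono fun x => ?_
    by_cases hx : x ∈ Ioi (√s)
    · have hx0 : x ∈ Ioi (0 : ℝ) := hsq.trans hx
      have hx2 : x ∈ {x : ℝ | s ≤ x ^ 2} := (Real.sqrt_le_left hx0.out.le).mp (le_of_lt hx)
      rw [indicator_of_mem hx, indicator_of_mem hx0, indicator_of_mem hx2]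
    · rw [indicator_of_notMem hx]; exact zero_le
  calc ∫⁻ ω, ENNReal.ofReal (S ω)⁻¹ ∂μ
      ≤ ∫⁻ ω, (∫⁻ x in Ioi (0 : ℝ), {x : ℝ | S ω ≤ x ^ 2}.indicator
        (fun x => ENNReal.ofReal (2 * (x ^ 3)⁻¹)) x) ∂μ := lintegral_mono fun ω => hcalc (S ω)
    _ = ∫⁻ x in Ioi (0 : ℝ), (∫⁻ ω, {x : ℝ | S ω ≤ x ^ 2}.indicator
        (fun x => ENNReal.ofReal (2 * (x ^ 3)⁻¹)) x ∂μ) := by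
        refine lintegral_lintegral_swap (Measurable.aemeasurable ?_)
        have hset : MeasurableSet {p : Ω × ℝ | S p.1 ≤ p.2 ^ 2} :=
          measurableSet_le (hSm.comp measurable_fst) (measurable_snd.pow_const 2)
        have hf : Measurable fun p : Ω × ℝ => ENNReal.ofReal (2 * (p.2 ^ 3)⁻¹) := by fun_prop
        exact hf.indicator hset
    _ ≤ _ := by
        refine setLIntegral_mono' measurableSet_Ioi fun x hx => ?_
        have hx0 : 0 < x := hx
        have : (fun ω => {x : ℝ | S ω ≤ x ^ 2}.indicator
            (fun x => ENNReal.ofReal (2 * (x ^ 3)⁻¹)) x) =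
            {ω | S ω ≤ x ^ 2}.indicator fun _ => ENNReal.ofReal (2 * (x ^ 3)⁻¹) := by
          ext ω; simp [indicator]
        rw [this, lintegral_indicator_const (measurableSet_le hSm measurable_const),
          ENNReal.ofReal_mul (p := 2 * (x ^ 3)⁻¹) (by positivity)]
        gcongr
        exact h x hx0

end HalfNormal

/-! ### The Gaussian product density and diagonal changes of variables. -/

section GaussianDensity

variable {ι : Type*} [Fintype ι]

theorem lintegral_pi_gaussianReal {f : (ι → ℝ) → ENNReal} (hf : Measurable f) :
    ∫⁻ y, f y ∂(Measure.pi fun _ : ι => gaussianReal 0 1) =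
      ENNReal.ofReal ((√(2 * Real.pi))⁻¹ ^ Fintype.card ι) *
        ∫⁻ y : ι → ℝ, ENNReal.ofReal (Real.exp (-(∑ i, y i ^ 2) / 2)) * f y := by
  have hprod : ∀ y : ι → ℝ, ∏ i, gaussianPDFReal 0 1 (y i) =
      (√(2 * Real.pi))⁻¹ ^ Fintype.card ι * Real.exp (-(∑ i, y i ^ 2) / 2) := by
    intro y
    simp only [gaussianPDFReal, Finset.prod_mul_distrib, ← Real.exp_sum]
    simp [Finset.sum_div, neg_div, Finset.sum_neg_distrib]
  have hmeas : Measurable fun y : ι → ℝ => ENNReal.ofReal (∏ i, gaussianPDFReal 0 1 (y i)) := by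
    refine ENNReal.measurable_ofReal.comp (Finset.measurable_prod _ fun i _ => ?_)
    exact (measurable_gaussianPDFReal 0 1).comp (measurable_pi_apply i)
  have hpi : (Measure.pi fun _ : ι => gaussianReal 0 1) =
      (volume : Measure (ι → ℝ)).withDensity
        fun y => ENNReal.ofReal (∏ i, gaussianPDFReal 0 1 (y i)) := by
    refine Measure.pi_eq fun s hs => ?_
    have hint : ∀ i, Integrable ((s i).indicator (gaussianPDFReal 0 1)) :=
      fun i => (integrable_gaussianPDFReal 0 1).indicator (hs i)
    have hnn : ∀ i x, 0 ≤ (s i).indicator (gaussianPDFReal 0 1) x :=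
      fun i x => indicator_nonneg (fun t _ => gaussianPDFReal_nonneg 0 1 t) x
    rw [withDensity_apply _ (MeasurableSet.univ_pi hs),
      ← lintegral_indicator (MeasurableSet.univ_pi hs)]
    have hind : ∀ y : ι → ℝ, (univ.pi s).indicator
        (fun y => ENNReal.ofReal (∏ i, gaussianPDFReal 0 1 (y i))) y =
        ENNReal.ofReal (∏ i, (s i).indicator (gaussianPDFReal 0 1) (y i)) := by
      intro y
      by_cases hy : y ∈ univ.pi s
      · rw [indicator_of_mem hy]
        congr 1
        exact Finset.prod_congr rfl fun i _ => by rw [indicator_of_mem (hy i (mem_univ i))]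
      · rw [indicator_of_notMem hy]
        simp only [mem_univ_pi, not_forall] at hy
        obtain ⟨i, hi⟩ := hy
        rw [Finset.prod_eq_zero (Finset.mem_univ i) (indicator_of_notMem hi _),
          ENNReal.ofReal_zero]
    simp_rw [hind]
    have hI : Integrable (fun y : ι → ℝ => ∏ i, (s i).indicator (gaussianPDFReal 0 1) (y i)) := by
      rw [volume_pi]
      exact Integrable.fintype_prod hint
    have hkey := ofReal_integral_eq_lintegral_ofReal hI
      (Eventually.of_forall fun y => Finset.prod_nonneg fun i _ => hnn i _)
    refine hkey.symm.trans ?_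
    rw [integral_fintype_prod_volume_eq_prod,
      ENNReal.ofReal_prod_of_nonneg fun i _ => integral_nonneg (hnn i)]
    refine Finset.prod_congr rfl fun i _ => ?_
    rw [gaussianReal_apply_eq_integral 0 one_ne_zero, integral_indicator (hs i)]
  rw [hpi, lintegral_withDensity_eq_lintegral_mul _ hmeas hf, ← lintegral_const_mul]
  · refine lintegral_congr fun y => ?_
    rw [Pi.mul_apply, hprod, ENNReal.ofReal_mul (by positivity), mul_assoc]
  · fun_prop

theorem lintegral_comp_pi_mul {F : (ι → ℝ) → ENNReal} (hF : Measurable F) {d : ι → ℝ}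
    (hd : ∀ i, 0 < d i) :
    ∫⁻ y, F y = ENNReal.ofReal (∏ i, d i) * ∫⁻ w : ι → ℝ, F (fun i => d i * w i) := by
  classical
  have hdet : (Matrix.diagonal d).det = ∏ i, d i := Matrix.det_diagonal
  have hpos : 0 < ∏ i, d i := Finset.prod_pos fun i _ => hd i
  have h := Real.smul_map_diagonal_volume_pi (D := d) (by rw [hdet]; exact hpos.ne')
  conv_lhs => rw [← h]
  rw [hdet, abs_of_pos hpos, lintegral_smul_measure, smul_eq_mul, lintegral_map hF]
  · congr 1
    refine lintegral_congr fun w => ?_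
    congr 1
    ext i
    simp [Matrix.toLin'_apply, Matrix.mulVec_diagonal]
  · exact (LinearMap.continuous_of_finiteDimensional _).measurable

end GaussianDensity

/-! ### The secular equation and the law of its root. -/

noncomputable section SecularEquation

variable {ι : Type*} [Fintype ι]

/-- The secular function of a rank-one perturbation `-diag L + y yᵀ`. -/
def secular (L y : ι → ℝ) (t : ℝ) : ℝ := ∑ j, y j ^ 2 / (t + L j)

variable {L : ι → ℝ}

theorem secular_nonneg (hL : ∀ j, 0 ≤ L j) (y : ι → ℝ) {t : ℝ} (ht : 0 < t) :
    0 ≤ secular L y t :=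
  Finset.sum_nonneg fun j _ => div_nonneg (sq_nonneg _) (by linarith [hL j])

theorem hasDerivAt_secular (hL : ∀ j, 0 ≤ L j) (y : ι → ℝ) {t : ℝ} (ht : 0 < t) :
    HasDerivAt (secular L y) (-∑ j, y j ^ 2 / (t + L j) ^ 2) t := by
  unfold secular
  rw [← Finset.sum_neg_distrib]
  refine HasDerivAt.fun_sum fun j _ => ?_
  have h0 : t + L j ≠ 0 := by linarith [hL j]
  have := (((hasDerivAt_id t).add_const (L j)).inv h0).const_mul (y j ^ 2)
  simp only [div_eq_mul_inv]
  refine HasDerivAt.congr_deriv this ?_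
  simp [div_eq_mul_inv]

theorem secular_strictAntiOn (hL : ∀ j, 0 ≤ L j) {y : ι → ℝ} {i : ι} (hy : y i ≠ 0) :
    StrictAntiOn (secular L y) (Ioi 0) := by
  intro s hs t ht hst
  have hs0 : 0 < s := hs
  refine Finset.sum_lt_sum (fun j _ => ?_) ⟨i, Finset.mem_univ i, ?_⟩
  · exact div_le_div_of_nonneg_left (sq_nonneg _) (by linarith [hL j]) (by linarith)
  · exact div_lt_div_of_pos_left (by positivity) (by linarith [hL i]) (by linarith)

/-- The term with `L i = 0` makes the function at least 2 at `y i ^ 2 / 2`, while at `t = ∑ y j ^ 2`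
it is at most 1; the intermediate value theorem does the rest. -/
theorem Ioo_subset_image_secular (hL : ∀ j, 0 ≤ L j) {y : ι → ℝ} {i : ι} (hi : L i = 0)
    (hy : y i ≠ 0) : Ioo 1 2 ⊆ secular L y '' Ioi 0 := by
  have hyi : 0 < y i ^ 2 := by positivity
  set N := ∑ j, y j ^ 2 with hN
  have hle : y i ^ 2 ≤ N := Finset.single_le_sum (f := fun j => y j ^ 2)
    (fun j _ => sq_nonneg _) (Finset.mem_univ i)
  have h1 : 2 ≤ secular L y (y i ^ 2 / 2) := by
    have : y i ^ 2 / (y i ^ 2 / 2 + L i) ≤ secular L y (y i ^ 2 / 2) :=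
      Finset.single_le_sum (f := fun j => y j ^ 2 / (y i ^ 2 / 2 + L j))
      (fun j _ => div_nonneg (sq_nonneg _) (by linarith [hL j])) (Finset.mem_univ i)
    refine le_trans (le_of_eq ?_) this
    rw [hi, add_zero]
    field_simp
  have h2 : secular L y N ≤ 1 := by
    have hN0 : 0 < N := hyi.trans_le hle
    calc secular L y N ≤ ∑ j, y j ^ 2 / N := Finset.sum_le_sum fun j _ =>
          div_le_div_of_nonneg_left (sq_nonneg _) hN0 (by linarith [hL j])
      _ = 1 := by rw [← Finset.sum_div, ← hN, div_self hN0.ne']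
  have hsub : Icc (y i ^ 2 / 2) N ⊆ Ioi 0 := fun t ht =>
    lt_of_lt_of_le (by positivity : 0 < y i ^ 2 / 2) ht.1
  have hivt := intermediate_value_Icc' (f := secular L y) (by linarith : y i ^ 2 / 2 ≤ N)
    fun t ht => (hasDerivAt_secular hL y (hsub ht)).continuousAt.continuousWithinAt
  intro v hv
  obtain ⟨t, ht, rfl⟩ := hivt ⟨h2.trans hv.1.le, hv.2.le.trans h1⟩
  exact ⟨t, hsub ht, rfl⟩

/-- The density of the largest eigenvalue of `-diag L + y yᵀ` for a standard Gaussian vector `y`,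
in polar-type coordinates. -/
def secularDensity (L : ι → ℝ) (t : ℝ) : ENNReal :=
  ENNReal.ofReal ((√(2 * Real.pi))⁻¹ ^ Fintype.card ι) *
    ∫⁻ w : ι → ℝ, (Ioo (1 : ℝ) 2).indicator 1 (∑ j, w j ^ 2) *
      ENNReal.ofReal ((∏ j, √(t + L j)) * (∑ j, w j ^ 2 / (t + L j)) *
        ((√(∑ j, w j ^ 2))⁻¹ ^ Fintype.card ι *
          Real.exp (-(∑ j, (t + L j) * w j ^ 2) / (2 * ∑ j, w j ^ 2))))

/-- Likelihood ratio domination: the density is nondecreasing relative to `t ^ (-1/2) * exp (-t/2)`,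
the unnormalized chi-squared density. -/
theorem secularDensity_mul_le (hL : ∀ j, 0 ≤ L j) {t r : ℝ} (ht : 0 < t) (htr : t ≤ r) :
    secularDensity L t * ENNReal.ofReal (√(t / r) * Real.exp (-(r - t) / 2)) ≤
      secularDensity L r := by
  classical
  have hr : 0 < r := ht.trans_le htr
  unfold secularDensity
  rw [mul_assoc, ← lintegral_mul_const' _ _ ENNReal.ofReal_ne_top]
  refine mul_le_mul' le_rfl (lintegral_mono fun w => (mul_assoc _ _ _).le.trans ?_)
  by_cases hs : (∑ j, w j ^ 2) ∈ Ioo (1 : ℝ) 2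
  swap
  · simp [indicator_of_notMem hs]
  refine mul_le_mul' le_rfl ?_
  rw [← ENNReal.ofReal_mul (by
    have : ∀ j, 0 < t + L j := fun j => by linarith [hL j]
    have : ∀ j, 0 ≤ w j ^ 2 / (t + L j) := fun j => div_nonneg (sq_nonneg _) (this j).le
    have := Finset.sum_nonneg fun j (_ : j ∈ Finset.univ) => this j
    positivity)]
  refine ENNReal.ofReal_le_ofReal ?_
  set s := ∑ j, w j ^ 2 with hs_def
  have hs0 : 0 < s := zero_lt_one.trans hs.1
  have hexp : ∀ t, Real.exp (-(∑ j, (t + L j) * w j ^ 2) / (2 * s)) =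
      Real.exp (-t / 2) * Real.exp (-(∑ j, L j * w j ^ 2) / (2 * s)) := by
    intro t
    rw [← Real.exp_add]
    congr 1
    simp only [add_mul, Finset.sum_add_distrib, ← Finset.mul_sum, ← hs_def]
    field_simp
    ring
  have hmain : (∏ j, √(t + L j)) * (∑ j, w j ^ 2 / (t + L j)) * √(t / r) ≤
      (∏ j, √(r + L j)) * (∑ j, w j ^ 2 / (r + L j)) := by
    rw [Finset.mul_sum, Finset.mul_sum, Finset.sum_mul]
    refine Finset.sum_le_sum fun j _ => ?_
    have htj : 0 < t + L j := by linarith [hL j]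
    have hrj : 0 < r + L j := by linarith [hL j]
    rw [← Finset.mul_prod_erase _ _ (Finset.mem_univ j),
      ← Finset.mul_prod_erase (f := fun j => √(r + L j)) _ (Finset.mem_univ j)]
    have hP : ∏ i ∈ Finset.univ.erase j, √(t + L i) ≤ ∏ i ∈ Finset.univ.erase j, √(r + L i) :=
      Finset.prod_le_prod (fun i _ => Real.sqrt_nonneg _)
        fun i _ => Real.sqrt_le_sqrt (by linarith)
    have hP0 : 0 ≤ ∏ i ∈ Finset.univ.erase j, √(t + L i) :=
      Finset.prod_nonneg fun i _ => Real.sqrt_nonneg _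
    -- After squaring this is `t (r + L j) ≤ r (t + L j)`. It is the only factor that decreases from
    -- `t` to `r` apart from the exponential, and it loses no more than in the chi-squared case `L j
    -- = 0`.
    have hq : √(t + L j) / (t + L j) * √(t / r) ≤ √(r + L j) / (r + L j) := by
      rw [Real.sqrt_div_self, Real.sqrt_div_self, ← Real.sqrt_inv, ← Real.sqrt_inv,
        ← Real.sqrt_mul (by positivity)]
      refine Real.sqrt_le_sqrt ?_
      rw [inv_mul_eq_div, div_div, inv_eq_one_div, div_le_div_iff₀ (by positivity) hrj]
      nlinarith [mul_nonneg (hL j) (sub_nonneg.mpr htr)]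
    calc √(t + L j) * (∏ i ∈ Finset.univ.erase j, √(t + L i)) * (w j ^ 2 / (t + L j)) * √(t / r)
        = w j ^ 2 * (∏ i ∈ Finset.univ.erase j, √(t + L i)) *
          (√(t + L j) / (t + L j) * √(t / r)) := by ring
      _ ≤ w j ^ 2 * (∏ i ∈ Finset.univ.erase j, √(r + L i)) * (√(r + L j) / (r + L j)) := by
          gcongr
      _ = _ := by ring
  rw [hexp, hexp]
  have he : Real.exp (-t / 2) * Real.exp (-(r - t) / 2) = Real.exp (-r / 2) := by
    rw [← Real.exp_add]; congr 1; ring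
  calc (∏ j, √(t + L j)) * (∑ j, w j ^ 2 / (t + L j)) *
        ((√s)⁻¹ ^ Fintype.card ι *
          (Real.exp (-t / 2) * Real.exp (-(∑ j, L j * w j ^ 2) / (2 * s)))) *
        (√(t / r) * Real.exp (-(r - t) / 2))
      = (∏ j, √(t + L j)) * (∑ j, w j ^ 2 / (t + L j)) * √(t / r) * ((√s)⁻¹ ^ Fintype.card ι *
          ((Real.exp (-t / 2) * Real.exp (-(r - t) / 2)) *
            Real.exp (-(∑ j, L j * w j ^ 2) / (2 * s)))) := by ring
    _ ≤ _ := by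
      rw [he]
      gcongr

/-- Dividing the vector by `√v` divides its secular function by `v`, so the value at `t` becomes 1;
strict monotonicity excludes a smaller root. As `hroot` speaks only of positive thresholds, a
threshold `s ≤ 0` is replaced by `t / 2`. -/
theorem secularRoot_inv_sqrt_mul (hL : ∀ j, 0 ≤ L j) {i : ι} {T : (ι → ℝ) → ℝ}
    (hroot : ∀ y, ∀ t > 0, T y ≤ t ↔ secular L y t ≤ 1) {z : ι → ℝ} (hz : z i ≠ 0) {t : ℝ}
    (ht : 0 < t) : T (fun j => (√(secular L z t))⁻¹ * z j) = t := by
  set v := secular L z t with hv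
  have hv0 : 0 < v := by
    have h1 := secular_nonneg hL z (t := t + 1) (by linarith)
    have h2 := secular_strictAntiOn hL hz ht (show t + 1 ∈ Ioi (0 : ℝ) by simp; linarith)
      (lt_add_one t)
    linarith
  have hsc : ∀ s, secular L (fun j => (√v)⁻¹ * z j) s = v⁻¹ * secular L z s := by
    intro s
    simp only [secular, mul_pow, inv_pow, Real.sq_sqrt hv0.le, Finset.mul_sum, mul_div_assoc]
  refine le_antisymm ?_ (le_of_forall_lt fun s hs => ?_)
  · rw [hroot _ t ht, hsc, ← hv, inv_mul_cancel₀ hv0.ne']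
  · rcases le_or_gt s 0 with hs0 | hs0
    · have hs' : T (fun j => (√v)⁻¹ * z j) > t / 2 := by
        rw [gt_iff_lt, ← not_le, hroot _ _ (by linarith), hsc, inv_mul_le_iff₀ hv0, mul_one,
          not_le]
        exact secular_strictAntiOn hL hz (show t / 2 ∈ Ioi (0 : ℝ) by simp; linarith) ht
          (by linarith)
      linarith
    · rw [← not_le, hroot _ _ hs0, hsc, inv_mul_le_iff₀ hv0, mul_one, not_le]
      exact secular_strictAntiOn hL hz hs0 ht hs

/-- The law of the largest root of the secular equation. -/
theorem lintegral_comp_secularRoot (hL : ∀ j, 0 ≤ L j) {i : ι} (hi : L i = 0)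
    {T : (ι → ℝ) → ℝ} (hT : Measurable T)
    (hroot : ∀ y, ∀ t > 0, T y ≤ t ↔ secular L y t ≤ 1)
    {f : ℝ → ENNReal} (hf : Measurable f) :
    ∫⁻ y, f (T y) ∂(Measure.pi fun _ : ι => gaussianReal 0 1) =
      ∫⁻ t in Ioi (0 : ℝ), f t * secularDensity L t := by
  have hrooteq : ∀ (z : ι → ℝ), z i ≠ 0 → ∀ t > 0,
      T (fun j => (√(secular L z t))⁻¹ * z j) = t :=
    fun z hz t ht => secularRoot_inv_sqrt_mul hL hroot hz ht
  set c := Fintype.card ι with hc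
  -- The integral is invariant under the dilation `y = z / √v`. The free parameter `v` is averaged
  -- over `(1, 2)`, an interval of length 1, and is later traded for the root.
  have hTs : ∀ v : ℝ, 0 < v →
      ∫⁻ y : ι → ℝ, ENNReal.ofReal (Real.exp (-(∑ j, y j ^ 2) / 2)) * f (T y) =
      ∫⁻ z : ι → ℝ, ENNReal.ofReal ((√v)⁻¹ ^ c * Real.exp (-(∑ j, z j ^ 2) / (2 * v))) *
        f (T fun j => (√v)⁻¹ * z j) := by
    intro v hv
    have hsv : 0 < (√v)⁻¹ := inv_pos.mpr (Real.sqrt_pos.mpr hv)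
    rw [lintegral_comp_pi_mul (d := fun _ : ι => (√v)⁻¹) (by fun_prop) fun _ => hsv,
      ← lintegral_const_mul _ (by fun_prop)]
    refine lintegral_congr fun z => ?_
    rw [Finset.prod_const, Finset.card_univ, ← hc, ← mul_assoc,
      ← ENNReal.ofReal_mul (by positivity)]
    congr 4
    simp only [mul_pow, inv_pow, Real.sq_sqrt hv.le, ← Finset.mul_sum]
    field_simp
  have hmeas1 : Measurable fun p : ℝ × (ι → ℝ) =>
      ENNReal.ofReal ((√p.1)⁻¹ ^ c * Real.exp (-(∑ j, p.2 j ^ 2) / (2 * p.1))) *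
        f (T fun j => (√p.1)⁻¹ * p.2 j) := by
    fun_prop
  have hsecm : Measurable fun p : (ι → ℝ) × ℝ => secular L p.1 p.2 := by
    unfold secular; fun_prop
  have hindm : Measurable ((Ioo (1 : ℝ) 2).indicator (1 : ℝ → ENNReal)) :=
    measurable_one.indicator measurableSet_Ioo
  have hmeas2 : Measurable fun p : (ι → ℝ) × ℝ =>
      ENNReal.ofReal (∑ j, p.1 j ^ 2 / (p.2 + L j) ^ 2) *
        ((Ioo (1 : ℝ) 2).indicator 1 (secular L p.1 p.2) *
          ENNReal.ofReal ((√(secular L p.1 p.2))⁻¹ ^ c *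
            Real.exp (-(∑ j, p.1 j ^ 2) / (2 * secular L p.1 p.2))) * f p.2) := by
    have : Measurable fun p : (ι → ℝ) × ℝ =>
      (Ioo (1 : ℝ) 2).indicator (1 : ℝ → ENNReal) (secular L p.1 p.2) := hindm.comp hsecm
    fun_prop
  have hae : ∀ᵐ z : ι → ℝ, z i ≠ 0 := by
    have : ∀ᵐ x : ℝ, x ≠ 0 := by simp [ae_iff, measure_singleton]
    exact (Measure.quasiMeasurePreserving_eval (fun _ : ι => (volume : Measure ℝ)) i).ae this
  rw [lintegral_pi_gaussianReal (by fun_prop)]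
  set I := ∫⁻ y : ι → ℝ, ENNReal.ofReal (Real.exp (-(∑ j, y j ^ 2) / 2)) * f (T y) with hI
  have hone : I = ∫⁻ v in Ioo (1 : ℝ) 2, I := by
    rw [setLIntegral_const, Real.volume_Ioo]; norm_num
  -- For fixed `z`, substitute `v = secular L z t`: the root of the dilated vector is then `t`
  -- itself.
  have hchange : ∀ z : ι → ℝ, z i ≠ 0 →
      ∫⁻ v in Ioo (1 : ℝ) 2, ENNReal.ofReal ((√v)⁻¹ ^ c *
        Real.exp (-(∑ j, z j ^ 2) / (2 * v))) * f (T fun j => (√v)⁻¹ * z j) =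
      ∫⁻ t in Ioi (0 : ℝ), ENNReal.ofReal (∑ j, z j ^ 2 / (t + L j) ^ 2) *
        ((Ioo (1 : ℝ) 2).indicator 1 (secular L z t) *
          ENNReal.ofReal ((√(secular L z t))⁻¹ ^ c *
            Real.exp (-(∑ j, z j ^ 2) / (2 * secular L z t))) * f t) := by
    intro z hz
    have h := lintegral_image_eq_lintegral_abs_deriv_mul measurableSet_Ioi
      (fun t ht => (hasDerivAt_secular hL z ht).hasDerivWithinAt)
      (secular_strictAntiOn hL hz).injOn
      ((Ioo (1 : ℝ) 2).indicator fun v => ENNReal.ofReal ((√v)⁻¹ ^ c *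
        Real.exp (-(∑ j, z j ^ 2) / (2 * v))) * f (T fun j => (√v)⁻¹ * z j))
    rw [setLIntegral_indicator measurableSet_Ioo,
      inter_eq_left.mpr (Ioo_subset_image_secular hL hi hz)] at h
    rw [h]
    refine setLIntegral_congr_fun measurableSet_Ioi fun t ht => ?_
    rw [abs_neg, abs_of_nonneg (Finset.sum_nonneg fun j _ => by positivity)]
    congr 1
    by_cases hmem : secular L z t ∈ Ioo (1 : ℝ) 2
    · rw [indicator_of_mem hmem, indicator_of_mem hmem, hrooteq z hz t ht, Pi.one_apply, one_mul]
    · rw [indicator_of_notMem hmem, indicator_of_notMem hmem, zero_mul, zero_mul]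
  have hswap : I = ∫⁻ t in Ioi (0 : ℝ), ∫⁻ z : ι → ℝ,
      ENNReal.ofReal (∑ j, z j ^ 2 / (t + L j) ^ 2) *
        ((Ioo (1 : ℝ) 2).indicator 1 (secular L z t) *
          ENNReal.ofReal ((√(secular L z t))⁻¹ ^ c *
            Real.exp (-(∑ j, z j ^ 2) / (2 * secular L z t))) * f t) := by
    rw [hone, setLIntegral_congr_fun measurableSet_Ioo
      fun v hv => hTs v (zero_lt_one.trans hv.1)]
    rw [lintegral_lintegral_swap hmeas1.aemeasurable,
      lintegral_congr_ae (hae.mono fun z hz => hchange z hz),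
      lintegral_lintegral_swap hmeas2.aemeasurable]
  rw [hswap, ← lintegral_const_mul]
  swap
  · exact Measurable.lintegral_prod_left' hmeas2
  refine setLIntegral_congr_fun measurableSet_Ioi fun t ht => ?_
  have htj : ∀ j, 0 < t + L j := fun j => by linarith [hL j, mem_Ioi.mp ht]
  rw [secularDensity, mul_left_comm]
  congr 1
  have hmeas3 : Measurable fun z : ι → ℝ => ENNReal.ofReal (∑ j, z j ^ 2 / (t + L j) ^ 2) *
      ((Ioo (1 : ℝ) 2).indicator 1 (secular L z t) *
        ENNReal.ofReal ((√(secular L z t))⁻¹ ^ c *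
          Real.exp (-(∑ j, z j ^ 2) / (2 * secular L z t))) * f t) := by
    have h1 : Measurable fun z : ι → ℝ => secular L z t := by unfold secular; fun_prop
    have h2 : Measurable fun z : ι → ℝ =>
      (Ioo (1 : ℝ) 2).indicator (1 : ℝ → ENNReal) (secular L z t) := hindm.comp h1
    fun_prop
  -- For fixed `t`, the substitution `z j = √(t + L j) * w j` turns the secular function into `∑ w j
  -- ^ 2`, so that the domain no longer depends on `t`.
  rw [lintegral_comp_pi_mul (d := fun j => √(t + L j)) hmeas3 fun j => Real.sqrt_pos.mpr (htj j),
    ← lintegral_const_mul' _ _ ENNReal.ofReal_ne_top,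
    ← lintegral_const_mul]
  · refine lintegral_congr fun w => ?_
    have e1 : secular L (fun j => √(t + L j) * w j) t = ∑ j, w j ^ 2 := by
      refine Finset.sum_congr rfl fun j _ => ?_
      rw [mul_pow, Real.sq_sqrt (htj j).le, mul_div_cancel_left₀ _ (htj j).ne']
    have e2 : ∑ j, (√(t + L j) * w j) ^ 2 / (t + L j) ^ 2 = ∑ j, w j ^ 2 / (t + L j) := by
      refine Finset.sum_congr rfl fun j _ => ?_
      rw [mul_pow, Real.sq_sqrt (htj j).le, sq (t + L j), mul_div_mul_left _ _ (htj j).ne']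
    have e3 : ∑ j, (√(t + L j) * w j) ^ 2 = ∑ j, (t + L j) * w j ^ 2 := by
      refine Finset.sum_congr rfl fun j _ => ?_
      rw [mul_pow, Real.sq_sqrt (htj j).le]
    rw [e1, e2, e3, ENNReal.ofReal_mul (p := (∏ j, √(t + L j)) * _) (by
      have := Finset.sum_nonneg fun j (_ : j ∈ Finset.univ) =>
        div_nonneg (sq_nonneg (w j)) (htj j).le
      positivity), ENNReal.ofReal_mul (p := ∏ j, √(t + L j)) (by positivity)]
    ring
  · have : Measurable fun w : ι → ℝ =>
      (Ioo (1 : ℝ) 2).indicator (1 : ℝ → ENNReal) (∑ j, w j ^ 2) := hindm.comp (by fun_prop)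
    fun_prop

end SecularEquation

/-! ### Hazard bounds from likelihood ratio domination. -/

section DensityBound

variable {g : ℝ → ENNReal}

/-- A density dominating the chi-squared density with one degree of freedom in the likelihood ratio
order has a smaller hazard. -/
theorem density_le_lintegral_Ioi
    (hg : ∀ t r : ℝ, 0 < t → t ≤ r → g t * ENNReal.ofReal (√(t / r) * Real.exp (-(r - t) / 2)) ≤ g r)
    {t : ℝ} (ht : 0 < t) :
    g t ≤ ∫⁻ r in Ioi t, ENNReal.ofReal (1 / 2 + 1 / 2 * r⁻¹) * g r := by
  -- Up to sign, the ratio of the chi-squared density at `r` to that at `t`. Its derivative carries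
  -- the weight `1/2 + 1/(2r)`, and its total increase over `(t, ∞)` is 1.
  set F : ℝ → ℝ := fun r => -(√(t / r) * Real.exp (-(r - t) / 2)) with hF
  have hderiv : ∀ r ∈ Ici t, HasDerivAt F
      ((1 / 2 + 1 / 2 * r⁻¹) * (√(t / r) * Real.exp (-(r - t) / 2))) r := by
    intro r hr
    have hr0 : 0 < r := ht.trans_le hr
    have h1 : HasDerivAt (fun r : ℝ => t / r) (-(t / r ^ 2)) r := by
      have := (hasDerivAt_inv hr0.ne').const_mul t
      refine HasDerivAt.congr_deriv this ?_
      rw [div_eq_mul_inv]; ring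
    have h2 := h1.sqrt (by positivity)
    have h3 : HasDerivAt (fun r : ℝ => Real.exp (-(r - t) / 2))
        (Real.exp (-(r - t) / 2) * (-1 / 2)) r :=
      ((((hasDerivAt_id r).sub_const t).neg).div_const 2).exp
    refine HasDerivAt.congr_deriv (h2.mul h3).neg ?_
    have hs : √(t / r) * √(t / r) = t / r := Real.mul_self_sqrt (by positivity)
    have hs0 : 0 < √(t / r) := Real.sqrt_pos.mpr (by positivity)
    have h4 : -(t / r ^ 2) / (2 * √(t / r)) = -(1 / 2 * r⁻¹ * √(t / r)) := by
      rw [div_eq_iff (by positivity)]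
      have : t / r ^ 2 = r⁻¹ * (√(t / r) * √(t / r)) := by rw [hs]; field_simp
      rw [this]; ring
    rw [h4]
    ring
  have hpos : ∀ r ∈ Ioi t,
      0 ≤ (1 / 2 + 1 / 2 * r⁻¹) * (√(t / r) * Real.exp (-(r - t) / 2)) := by
    intro r hr
    have hr0 : 0 < r := ht.trans hr
    positivity
  have hlim : Tendsto F atTop (𝓝 0) := by
    have h1 : Tendsto (fun r : ℝ => √(t / r)) atTop (𝓝 0) := by
      have := (Real.continuous_sqrt.tendsto 0).comp
        ((tendsto_inv_atTop_zero (𝕜 := ℝ)).const_mul t |>.trans (by rw [mul_zero]))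
      simpa [Function.comp_def, div_eq_mul_inv] using this
    have h2 : Tendsto (fun r : ℝ => Real.exp (-(r - t) / 2)) atTop (𝓝 0) := by
      refine Real.tendsto_exp_atBot.comp ?_
      have h3 : Tendsto (fun r : ℝ => (r + -t) / 2) atTop atTop :=
        (tendsto_atTop_add_const_right _ _ tendsto_id).atTop_div_const two_pos
      refine (tendsto_neg_atTop_atBot.comp h3).congr fun r => ?_
      simp only [Function.comp]; ring
    simpa [hF] using (h1.mul h2).neg
  have h1 := integral_Ioi_of_hasDerivAt_of_nonneg' hderiv hpos hlim
  have h2 := integrableOn_Ioi_deriv_of_nonneg' hderiv hpos hlim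
  have hFt : F t = -1 := by simp [hF, ht.ne']
  rw [hFt, zero_sub, neg_neg] at h1
  have h3 := ofReal_integral_eq_lintegral_ofReal h2
    ((ae_restrict_mem measurableSet_Ioi).mono fun r hr => hpos r hr)
  rw [h1, ENNReal.ofReal_one] at h3
  have hm : Measurable fun r => ENNReal.ofReal
      ((1 / 2 + 1 / 2 * r⁻¹) * (√(t / r) * Real.exp (-(r - t) / 2))) := by fun_prop
  calc g t = ∫⁻ r in Ioi t, g t * ENNReal.ofReal
        ((1 / 2 + 1 / 2 * r⁻¹) * (√(t / r) * Real.exp (-(r - t) / 2))) := by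
        rw [lintegral_const_mul _ hm, ← h3, mul_one]
    _ ≤ _ := by
        refine setLIntegral_mono_ae' measurableSet_Ioi (Eventually.of_forall fun r hr => ?_)
        have hr0 : 0 < r := ht.trans hr
        rw [ENNReal.ofReal_mul (by positivity), mul_left_comm]
        exact mul_le_mul' le_rfl (hg t r ht (le_of_lt hr))

/-- Beyond `b` the density is bounded by the constant `H`, its hazard integral from `b`; what
remains is the area `a²/2` of a triangle. -/
theorem lintegral_Ioi_mul_density_le
    (hg : ∀ t r : ℝ, 0 < t → t ≤ r → g t * ENNReal.ofReal (√(t / r) * Real.exp (-(r - t) / 2)) ≤ g r)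
    {a b : ℝ} (ha : 0 ≤ a) (hb : 0 ≤ b) :
    ∫⁻ t in Ioi b, ENNReal.ofReal (a - (t - b)) * g t ≤
      ENNReal.ofReal (a ^ 2 / 2) *
        ∫⁻ r in Ioi b, ENNReal.ofReal (1 / 2 + 1 / 2 * r⁻¹) * g r := by
  set H := ∫⁻ r in Ioi b, ENNReal.ofReal (1 / 2 + 1 / 2 * r⁻¹) * g r with hH
  have hm : Measurable fun t : ℝ => ENNReal.ofReal (a - (t - b)) := by fun_prop
  have htri : ∫⁻ t in Ioi b, ENNReal.ofReal (a - (t - b)) ≤ ENNReal.ofReal (a ^ 2 / 2) := by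
    have hsplit : ∫⁻ t in Ioi b, ENNReal.ofReal (a - (t - b)) ≤
        ∫⁻ t in Ioc b (b + a), ENNReal.ofReal (a - (t - b)) := by
      rw [← lintegral_indicator measurableSet_Ioi, ← lintegral_indicator measurableSet_Ioc]
      refine lintegral_mono fun t => ?_
      by_cases h1 : t ∈ Ioi b
      · by_cases h2 : t ≤ b + a
        · rw [indicator_of_mem h1, indicator_of_mem (show t ∈ Ioc b (b + a) from ⟨h1, h2⟩)]
        · rw [indicator_of_mem h1, ENNReal.ofReal_of_nonpos (by linarith)]; exact zero_le
      · rw [indicator_of_notMem h1]; exact zero_le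
    refine hsplit.trans (le_of_eq ?_)
    rw [← ofReal_integral_eq_lintegral_ofReal
      ((by fun_prop : Continuous fun t : ℝ => a - (t - b)).integrableOn_Ioc)
      ((ae_restrict_mem measurableSet_Ioc).mono fun t ht => by
        simp only [Pi.zero_apply]; linarith [ht.2]),
      ← intervalIntegral.integral_of_le (by linarith)]
    congr 1
    simp only [sub_eq_add_neg]
    have : ∀ t : ℝ, a + -(t + -b) = (a + b) - t := fun t => by ring
    simp_rw [this]
    rw [intervalIntegral.integral_sub (by simp) (by simp), intervalIntegral.integral_const,
      integral_id, smul_eq_mul]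
    ring
  calc ∫⁻ t in Ioi b, ENNReal.ofReal (a - (t - b)) * g t
      ≤ ∫⁻ t in Ioi b, ENNReal.ofReal (a - (t - b)) * H := by
        refine setLIntegral_mono_ae' measurableSet_Ioi (Eventually.of_forall fun t ht => ?_)
        refine mul_le_mul' le_rfl ((density_le_lintegral_Ioi hg (hb.trans_lt ht)).trans ?_)
        exact lintegral_mono_set (Ioi_subset_Ioi (le_of_lt ht))
    _ = (∫⁻ t in Ioi b, ENNReal.ofReal (a - (t - b))) * H := lintegral_mul_const _ hm
    _ ≤ _ := mul_le_mul' htri le_rfl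

end DensityBound

/-! ### Gap and inverse of the maximum of an independent sample. -/

section Maximum

/-- A law on the positive reals that is at least as spread out as the chi-squared law with one
degree of freedom, in the sense needed to control gaps and inverses of maxima of samples. -/
structure DominatesChiSq (ν : Measure ℝ) : Prop where
  measure_Iic_zero : ν (Iic 0) = 0
  measure_Iic_sq_le : ∀ x > (0 : ℝ), ν (Iic (x ^ 2)) ≤ ENNReal.ofReal (halfNormalCDF x)
  lintegral_Ici_le : ∀ a b : ℝ, 0 ≤ a → 0 ≤ b →
    ∫⁻ t in Ici b, ENNReal.ofReal (a - (t - b)) ∂ν ≤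
      ENNReal.ofReal (a ^ 2 / 2) * ∫⁻ t in Ioi b, ENNReal.ofReal (1 / 2 + 1 / 2 * t⁻¹) ∂ν

/-- The law lives on the positive reals with density `secularDensity`. The bound on the distribution
function holds because the single term `y i ^ 2 / t` of the secular function already forces the root
to be at least `y i ^ 2`. -/
theorem dominatesChiSq_map_secularRoot {ι : Type*} [Fintype ι] {L : ι → ℝ} (hL : ∀ j, 0 ≤ L j)
    {i : ι} (hi : L i = 0) {T : (ι → ℝ) → ℝ} (hT : Measurable T)
    (hroot : ∀ y, ∀ t > 0, T y ≤ t ↔ secular L y t ≤ 1) :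
    DominatesChiSq ((Measure.pi fun _ : ι => gaussianReal 0 1).map T) := by
  set γ := Measure.pi fun _ : ι => gaussianReal 0 1 with hγ
  have hlaw : ∀ {f : ℝ → ENNReal}, Measurable f →
      ∫⁻ t, f t ∂(γ.map T) = ∫⁻ t in Ioi (0 : ℝ), f t * secularDensity L t := by
    intro f hf
    rw [lintegral_map hf hT, lintegral_comp_secularRoot hL hi hT hroot hf]
  have hset : ∀ {f : ℝ → ENNReal} {s : Set ℝ}, Measurable f → MeasurableSet s → s ⊆ Ioi 0 →
      ∫⁻ t in s, f t ∂(γ.map T) = ∫⁻ t in s, f t * secularDensity L t := by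
    intro f s hf hs hs0
    rw [← lintegral_indicator hs, hlaw (hf.indicator hs), ← lintegral_indicator measurableSet_Ioi,
      ← lintegral_indicator hs]
    refine lintegral_congr fun t => ?_
    by_cases h : t ∈ s
    · rw [indicator_of_mem (hs0 h), indicator_of_mem h, indicator_of_mem h]
    · by_cases h0 : t ∈ Ioi (0 : ℝ)
      · rw [indicator_of_mem h0, indicator_of_notMem h, indicator_of_notMem h, zero_mul]
      · rw [indicator_of_notMem h0, indicator_of_notMem h]
  have hzero : (γ.map T) (Iic 0) = 0 := by
    rw [← lintegral_indicator_one measurableSet_Iic,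
      hlaw (measurable_one.indicator measurableSet_Iic)]
    rw [setLIntegral_congr_fun (g := fun _ => 0) measurableSet_Ioi fun t ht => ?_]
    · simp
    · rw [indicator_of_notMem (by simpa using ht), zero_mul]
  have hatom : ∀ b : ℝ, 0 ≤ b → (γ.map T) {b} = 0 := by
    intro b hb
    rcases hb.eq_or_lt with h | h
    · exact measure_mono_null (by simp [← h]) hzero
    · rw [← setLIntegral_one, hset measurable_const (measurableSet_singleton b)
        (by simpa using h)]
      exact setLIntegral_measure_zero _ _ (by simp)
  refine ⟨hzero, fun x hx => ?_, fun a b ha hb => ?_⟩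
  · rw [Measure.map_apply hT measurableSet_Iic, ← gaussianReal_Icc_neg_self hx.le]
    have hsub : T ⁻¹' Iic (x ^ 2) ⊆ Function.eval i ⁻¹' Icc (-x) x := by
      intro y hy
      have h1 := (hroot y (x ^ 2) (by positivity)).mp hy
      have h2 : y i ^ 2 / (x ^ 2 + L i) ≤ secular L y (x ^ 2) :=
        Finset.single_le_sum (f := fun j => y j ^ 2 / (x ^ 2 + L j))
          (fun j _ => div_nonneg (sq_nonneg _) (by have := hL j; positivity)) (Finset.mem_univ i)
      rw [hi, add_zero] at h2
      have h3 := (div_le_one (by positivity)).mp (h2.trans h1)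
      exact abs_le.mp (abs_le_of_sq_le_sq h3 hx.le)
    refine (measure_mono hsub).trans (le_of_eq ?_)
    exact (measurePreserving_eval (fun _ : ι => gaussianReal 0 1) i).measure_preimage
      measurableSet_Icc.nullMeasurableSet
  · have hIci : ∫⁻ t in Ici b, ENNReal.ofReal (a - (t - b)) ∂(γ.map T) =
        ∫⁻ t in Ioi b, ENNReal.ofReal (a - (t - b)) ∂(γ.map T) := by
      refine setLIntegral_congr ?_
      exact (Ioi_ae_eq_Ici' (hatom b hb)).symm
    rw [hIci, hset (by fun_prop) measurableSet_Ioi (Ioi_subset_Ioi hb),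
      hset (by fun_prop) measurableSet_Ioi (Ioi_subset_Ioi hb)]
    exact lintegral_Ioi_mul_density_le
      (fun t r ht htr => secularDensity_mul_le hL ht htr) ha hb

variable {Ω : Type*} [MeasurableSpace Ω] {μ : Measure Ω} [IsProbabilityMeasure μ]
  {k : ℕ} {T : Fin k → Ω → ℝ} {ν : Measure ℝ}

/-- The maximum of the entries of a vector other than the `i`-th one. -/
noncomputable def othersMax {k : ℕ} (t : Fin k → ℝ) (i : Fin k) : ℝ :=
  ⨆ j : (Finset.univ.erase i : Finset (Fin k)), t j

theorem le_othersMax (t : Fin k → ℝ) {i j : Fin k} (h : j ≠ i) : t j ≤ othersMax t i :=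
  le_ciSup (f := fun j : (Finset.univ.erase i : Finset (Fin k)) => t j)
    (Set.finite_range _).bddAbove ⟨j, by simp [h]⟩

theorem exists_eq_othersMax (hk : 2 ≤ k) (t : Fin k → ℝ) (i : Fin k) :
    ∃ j ≠ i, t j = othersMax t i := by
  have : Nontrivial (Fin k) := Fin.nontrivial_iff_two_le.mpr hk
  obtain ⟨j, hj⟩ := exists_ne i
  have : Nonempty (Finset.univ.erase i : Finset (Fin k)) := ⟨⟨j, by simp [hj]⟩⟩
  obtain ⟨⟨l, hl⟩, h⟩ := exists_eq_ciSup_of_finite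
    (f := fun j : (Finset.univ.erase i : Finset (Fin k)) => t j)
  exact ⟨l, by simpa using hl, h⟩

/-- The expected positive part of `a` minus the gap between the two largest values of a sample. -/
theorem lintegral_gap_le (hk : 2 ≤ k) (hν : DominatesChiSq ν) (hT : ∀ i, HasLaw (T i) ν μ)
    (hind : iIndepFun T μ) {a : ℝ} (ha : 0 ≤ a) :
    ∫⁻ ω, ∑ i, {t : Fin k → ℝ | othersMax t i ≤ t i}.indicator
        (fun t => ENNReal.ofReal (a - (t i - othersMax t i))) (fun j => T j ω) ∂μ ≤
      ENNReal.ofReal (a ^ 2 / 2) *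
        ∫⁻ ω, ENNReal.ofReal (1 / 2 + 1 / 2 * (⨆ i, T i ω)⁻¹) ∂μ := by
  have hTm : ∀ i, AEMeasurable (T i) μ := fun i => (hT i).aemeasurable
  have hBm : ∀ i, AEMeasurable (fun ω => othersMax (fun j => T j ω) i) μ :=
    fun i => AEMeasurable.iSup fun j => hTm j
  have hpos : ∀ᵐ ω ∂μ, ∀ i, 0 < T i ω := by
    refine ae_all_iff.mpr fun i => ?_
    rw [ae_iff]
    have := (hT i).map_eq ▸ hν.measure_Iic_zero
    rw [Measure.map_apply_of_aemeasurable (hTm i) measurableSet_Iic] at this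
    simpa [preimage, Iic] using this
  have hBpos : ∀ i, ∀ᵐ ω ∂μ, 0 ≤ othersMax (fun j => T j ω) i := by
    intro i
    filter_upwards [hpos] with ω hω
    obtain ⟨j, -, hj⟩ := exists_eq_othersMax hk (fun j => T j ω) i
    rw [← hj]
    exact (hω j).le
  have hprob : IsProbabilityMeasure ν :=
    (hT ⟨0, by lia⟩).isProbabilityMeasure_iff.mp inferInstance
  have hindep : ∀ i, IndepFun (T i) (fun ω => othersMax (fun j => T j ω) i) μ := by
    intro i
    have h := hind.indepFun_finset₀ {i} (Finset.univ.erase i) (by simp) hTm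
    have hm : Measurable fun u : ↥(Finset.univ.erase i : Finset (Fin k)) → ℝ => ⨆ j, u j :=
      Measurable.iSup fun j => measurable_pi_apply j
    exact h.comp (φ := fun u : ↥({i} : Finset (Fin k)) → ℝ => u ⟨i, by simp⟩)
      (measurable_pi_apply _) hm
  -- Condition on the maximum of the other entries, which is independent of `T i`. Ties are admitted
  -- on the left and excluded on the right.
  have hone : ∀ i, ∫⁻ ω, {t : Fin k → ℝ | othersMax t i ≤ t i}.indicator
        (fun t => ENNReal.ofReal (a - (t i - othersMax t i))) (fun j => T j ω) ∂μ ≤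
      ENNReal.ofReal (a ^ 2 / 2) * ∫⁻ ω, {t : Fin k → ℝ | othersMax t i < t i}.indicator
        (fun t => ENNReal.ofReal (1 / 2 + 1 / 2 * (t i)⁻¹)) (fun j => T j ω) ∂μ := by
    intro i
    set B : Ω → ℝ := fun ω => othersMax (fun j => T j ω) i with hB
    have hmap : μ.map (fun ω => (T i ω, B ω)) = ν.prod (μ.map B) := by
      rw [(indepFun_iff_map_prod_eq_prod_map_map (hTm i) (hBm i)).mp (hindep i), (hT i).map_eq]
    have hpair : AEMeasurable (fun ω => (T i ω, B ω)) μ := (hTm i).prodMk (hBm i)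
    have hprobB : IsProbabilityMeasure (μ.map B) := Measure.isProbabilityMeasure_map (hBm i)
    have hf : Measurable ({p : ℝ × ℝ | p.2 ≤ p.1}.indicator
        fun p => ENNReal.ofReal (a - (p.1 - p.2))) :=
      Measurable.indicator (by fun_prop) (measurableSet_le measurable_snd measurable_fst)
    have hg : Measurable ({p : ℝ × ℝ | p.2 < p.1}.indicator
        fun p => ENNReal.ofReal (1 / 2 + 1 / 2 * p.1⁻¹)) :=
      Measurable.indicator (by fun_prop) (measurableSet_lt measurable_snd measurable_fst)
    have e1 : ∫⁻ ω, {t : Fin k → ℝ | othersMax t i ≤ t i}.indicator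
        (fun t => ENNReal.ofReal (a - (t i - othersMax t i))) (fun j => T j ω) ∂μ =
        ∫⁻ b, ∫⁻ t, {p : ℝ × ℝ | p.2 ≤ p.1}.indicator
          (fun p => ENNReal.ofReal (a - (p.1 - p.2))) (t, b) ∂ν ∂(μ.map B) := by
      rw [← lintegral_prod_symm' _ hf, ← hmap, lintegral_map' hf.aemeasurable hpair]
      rfl
    have e2 : ∫⁻ ω, {t : Fin k → ℝ | othersMax t i < t i}.indicator
        (fun t => ENNReal.ofReal (1 / 2 + 1 / 2 * (t i)⁻¹)) (fun j => T j ω) ∂μ =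
        ∫⁻ b, ∫⁻ t, {p : ℝ × ℝ | p.2 < p.1}.indicator
          (fun p => ENNReal.ofReal (1 / 2 + 1 / 2 * p.1⁻¹)) (t, b) ∂ν ∂(μ.map B) := by
      rw [← lintegral_prod_symm' _ hg, ← hmap, lintegral_map' hg.aemeasurable hpair]
      rfl
    rw [e1, e2, ← lintegral_const_mul' _ _ ENNReal.ofReal_ne_top]
    refine lintegral_mono_ae ?_
    have hb : ∀ᵐ b ∂(μ.map B), 0 ≤ b := by
      rw [ae_map_iff (hBm i) measurableSet_Ici]
      exact hBpos i
    filter_upwards [hb] with b hb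
    have := hν.lintegral_Ici_le a b ha hb
    rw [← lintegral_indicator measurableSet_Ici, ← lintegral_indicator measurableSet_Ioi] at this
    exact this
  -- At most one entry strictly exceeds all the others, and it is then the maximum; hence the strict
  -- inequality on this side.
  have hsum : ∀ᵐ ω ∂μ, ∑ i, {t : Fin k → ℝ | othersMax t i < t i}.indicator
        (fun t => ENNReal.ofReal (1 / 2 + 1 / 2 * (t i)⁻¹)) (fun j => T j ω) ≤
      ENNReal.ofReal (1 / 2 + 1 / 2 * (⨆ i, T i ω)⁻¹) := by
    refine Eventually.of_forall fun ω => ?_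
    by_cases h : ∃ i, othersMax (fun j => T j ω) i < T i ω
    · obtain ⟨i, hi⟩ := h
      have hmax : ∀ j, T j ω ≤ T i ω := by
        intro j
        by_cases hj : j = i
        · rw [hj]
        · exact (le_othersMax (fun j => T j ω) hj).trans hi.le
      have : Nonempty (Fin k) := ⟨i⟩
      have hsup : ⨆ i, T i ω = T i ω :=
        le_antisymm (ciSup_le hmax) (le_ciSup (f := fun i => T i ω) (finite_range _).bddAbove i)
      rw [Finset.sum_eq_single i, hsup]
      · exact le_of_eq (indicator_of_mem
          (show (fun j => T j ω) ∈ {t : Fin k → ℝ | othersMax t i < t i} from hi) _)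
      · intro j _ hji
        refine indicator_of_notMem (fun hmem => ?_) _
        have h1 : othersMax (fun j => T j ω) j < T j ω := hmem
        have h2 := le_othersMax (fun j => T j ω) (Ne.symm hji)
        linarith [hmax j]
      · simp
    · push Not at h
      rw [Finset.sum_eq_zero]
      · exact zero_le
      · exact fun i _ => indicator_of_notMem (by simpa using h i) _
  rw [lintegral_finsetSum']
  · refine (Finset.sum_le_sum fun i _ => hone i).trans ?_
    rw [← Finset.mul_sum, ← lintegral_finsetSum']
    · exact mul_le_mul' le_rfl (lintegral_mono_ae hsum)
    · intro i _
      refine Measurable.comp_aemeasurable (g := {t : Fin k → ℝ | othersMax t i < t i}.indicator _)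
        ?_ (aemeasurable_pi_lambda _ hTm)
      have : Measurable fun t : Fin k → ℝ => othersMax t i :=
        Measurable.iSup fun j => measurable_pi_apply _
      exact Measurable.indicator (by fun_prop) (measurableSet_lt this (measurable_pi_apply i))
  · intro i _
    refine Measurable.comp_aemeasurable (g := {t : Fin k → ℝ | othersMax t i ≤ t i}.indicator _)
      ?_ (aemeasurable_pi_lambda _ hTm)
    have : Measurable fun t : Fin k → ℝ => othersMax t i :=
      Measurable.iSup fun j => measurable_pi_apply _
    exact Measurable.indicator (by fun_prop) (measurableSet_le this (measurable_pi_apply i))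

theorem lintegral_inv_iSup_le (hk : 3 ≤ k) (hν : DominatesChiSq ν) (hT : ∀ i, HasLaw (T i) ν μ)
    (hind : iIndepFun T μ) :
    ∫⁻ ω, ENNReal.ofReal (⨆ i, T i ω)⁻¹ ∂μ ≤
      ENNReal.ofReal (((k : ℝ) + 2) / (3 * ((k : ℝ) - 2))) := by
  have hTm : ∀ i, AEMeasurable (T i) μ := fun i => (hT i).aemeasurable
  refine lintegral_inv_le_of_measure_le hk (AEMeasurable.iSup hTm) fun x hx => ?_
  have hsub : {ω | ⨆ i, T i ω ≤ x ^ 2} ⊆ ⋂ i, T i ⁻¹' Iic (x ^ 2) := fun ω hω =>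
    mem_iInter.mpr fun i =>
      (le_ciSup (f := fun i => T i ω) (finite_range _).bddAbove i).trans hω
  refine (measure_mono hsub).trans ?_
  rw [hind.meas_iInter fun i => ⟨_, measurableSet_Iic, rfl⟩,
    ENNReal.ofReal_pow (halfNormalCDF_nonneg hx.le)]
  calc ∏ i, μ (T i ⁻¹' Iic (x ^ 2)) ≤ ∏ _i : Fin k, ENNReal.ofReal (halfNormalCDF x) := by
        refine Finset.prod_le_prod' fun i _ => ?_
        rw [← Measure.map_apply_of_aemeasurable (hTm i) measurableSet_Iic, (hT i).map_eq]
        exact hν.measure_Iic_sq_le x hx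
    _ = _ := by simp

end Maximum

/-! ### Perturbation of the largest eigenvalue of a symmetric matrix. -/

noncomputable section SymmetricMatrices

variable {n : ℕ}

/-- The array of products of the coordinates of two vectors. -/
def tens (x y : EuclideanSpace ℝ (Fin n)) : EuclideanSpace ℝ (Fin n × Fin n) :=
  WithLp.toLp 2 fun p => x p.1 * y p.2

theorem inner_tens_tens (a b x y : EuclideanSpace ℝ (Fin n)) :
    inner ℝ (tens a b) (tens x y) = inner ℝ a x * inner ℝ b y := by
  simp only [tens, PiLp.inner_apply, RCLike.inner_apply, conj_trivial, Fintype.sum_prod_type,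
    Finset.sum_mul_sum]
  exact Finset.sum_congr rfl fun i _ => Finset.sum_congr rfl fun j _ => by ring

theorem tens_add_left (x x' y : EuclideanSpace ℝ (Fin n)) :
    tens (x + x') y = tens x y + tens x' y := by
  ext p; simp [tens, add_mul]

theorem tens_add_right (x y y' : EuclideanSpace ℝ (Fin n)) :
    tens x (y + y') = tens x y + tens x y' := by
  ext p; simp [tens, mul_add]

theorem tens_smul_left (r : ℝ) (x y : EuclideanSpace ℝ (Fin n)) :
    tens (r • x) y = r • tens x y := by
  ext p; simp [tens, mul_assoc]

theorem tens_smul_right (r : ℝ) (x y : EuclideanSpace ℝ (Fin n)) :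
    tens x (r • y) = r • tens x y := by
  ext p; simp [tens, mul_left_comm]

/-- The symmetric rank-one matrix `z zᵀ`. -/
def symTens (z : EuclideanSpace ℝ (Fin n)) : SymMatrix n :=
  ⟨tens z z, fun i j => by simp [tens, mul_comm]⟩

/-- The bilinear form of a symmetric matrix. -/
def bil (X : SymMatrix n) (x y : EuclideanSpace ℝ (Fin n)) : ℝ :=
  inner ℝ (X : EuclideanSpace ℝ (Fin n × Fin n)) (tens x y)

/-- The largest eigenvalue of a symmetric matrix. -/
def topEig (X : SymMatrix n) : ℝ := lambdaMax (symToMatrix X)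

theorem bil_add (X Y : SymMatrix n) (x y : EuclideanSpace ℝ (Fin n)) :
    bil (X + Y) x y = bil X x y + bil Y x y := by
  simp [bil, inner_add_left]

theorem bil_smul (r : ℝ) (X : SymMatrix n) (x y : EuclideanSpace ℝ (Fin n)) :
    bil (r • X) x y = r * bil X x y := by
  simp [bil, inner_smul_left]

theorem bil_neg (X : SymMatrix n) (x y : EuclideanSpace ℝ (Fin n)) :
    bil (-X) x y = -bil X x y := by
  simp [bil]

theorem bil_add_left (X : SymMatrix n) (x x' y : EuclideanSpace ℝ (Fin n)) :
    bil X (x + x') y = bil X x y + bil X x' y := by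
  simp [bil, tens_add_left, inner_add_right]

theorem bil_add_right (X : SymMatrix n) (x y y' : EuclideanSpace ℝ (Fin n)) :
    bil X x (y + y') = bil X x y + bil X x y' := by
  simp [bil, tens_add_right, inner_add_right]

theorem bil_smul_left (X : SymMatrix n) (r : ℝ) (x y : EuclideanSpace ℝ (Fin n)) :
    bil X (r • x) y = r * bil X x y := by
  simp [bil, tens_smul_left, inner_smul_right]

theorem bil_smul_right (X : SymMatrix n) (r : ℝ) (x y : EuclideanSpace ℝ (Fin n)) :
    bil X x (r • y) = r * bil X x y := by
  simp [bil, tens_smul_right, inner_smul_right]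

theorem bil_symTens (z x y : EuclideanSpace ℝ (Fin n)) :
    bil (symTens z) x y = inner ℝ z x * inner ℝ z y :=
  inner_tens_tens z z x y

theorem bil_eq_sum (X : SymMatrix n) (x y : EuclideanSpace ℝ (Fin n)) :
    bil X x y = ∑ i, ∑ j, X.1 (i, j) * (x i * y j) := by
  simp only [bil, tens, PiLp.inner_apply, RCLike.inner_apply, conj_trivial, Fintype.sum_prod_type]
  exact Finset.sum_congr rfl fun i _ => Finset.sum_congr rfl fun j _ => by ring

theorem bil_comm (X : SymMatrix n) (x y : EuclideanSpace ℝ (Fin n)) : bil X x y = bil X y x := by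
  rw [bil_eq_sum, bil_eq_sum, Finset.sum_comm]
  exact Finset.sum_congr rfl fun i _ => Finset.sum_congr rfl fun j _ => by
    rw [X.2 j i, mul_comm (x j)]

theorem bil_eq_dotProduct (X : SymMatrix n) (x y : EuclideanSpace ℝ (Fin n)) :
    bil X x y = (symToMatrix X).mulVec x.ofLp ⬝ᵥ y.ofLp := by
  rw [bil_comm, bil_eq_sum]
  simp only [dotProduct, Matrix.mulVec, Finset.sum_mul, symToMatrix, Matrix.of_apply]
  exact Finset.sum_congr rfl fun i _ => Finset.sum_congr rfl fun j _ => by ring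

theorem symToMatrix_add_smul_symTens (X : SymMatrix n) (c : ℝ) (z : EuclideanSpace ℝ (Fin n)) :
    symToMatrix (X + c • symTens z) = symToMatrix X + c • Matrix.vecMulVec z.ofLp z.ofLp := by
  ext i j
  simp [symToMatrix, symTens, tens, Matrix.vecMulVec_apply]

/-- The spectral theorem for the bilinear form of a symmetric matrix. -/
theorem exists_eigenbasis (hn : 1 ≤ n) (X : SymMatrix n) :
    ∃ (b : OrthonormalBasis (Fin n) ℝ (EuclideanSpace ℝ (Fin n))) (l : Fin n → ℝ),
      (∀ j y, bil X (b j) y = l j * inner ℝ (b j) y) ∧ (∀ j, l j ≤ topEig X) ∧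
        ∃ i, l i = topEig X := by
  have hX := isHermitian_symToMatrix X
  have hg := isGreatest_lambdaMax hn hX
  have hs := hX.spectrum_real_eq_range_eigenvalues
  rw [hs] at hg
  refine ⟨hX.eigenvectorBasis, hX.eigenvalues, fun j y => ?_, fun j => hg.2 ⟨j, rfl⟩, hg.1⟩
  rw [bil_eq_dotProduct, hX.mulVec_eigenvectorBasis, smul_dotProduct, smul_eq_mul]
  congr 1
  rw [PiLp.inner_apply]
  exact Finset.sum_congr rfl fun i _ => by simp [mul_comm]

theorem bil_self_eq_sum {b : OrthonormalBasis (Fin n) ℝ (EuclideanSpace ℝ (Fin n))}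
    {l : Fin n → ℝ} {X : SymMatrix n} (h : ∀ j y, bil X (b j) y = l j * inner ℝ (b j) y)
    (x : EuclideanSpace ℝ (Fin n)) : bil X x x = ∑ j, l j * inner ℝ (b j) x ^ 2 := by
  have hsum : ∀ s : Finset (Fin n), bil X (∑ j ∈ s, inner ℝ (b j) x • b j) x =
      ∑ j ∈ s, l j * inner ℝ (b j) x ^ 2 := by
    intro s
    classical
    induction s using Finset.induction_on with
    | empty => simp [bil_eq_sum]
    | insert j s hj ih =>
      rw [Finset.sum_insert hj, Finset.sum_insert hj, bil_add_left, ih, bil_smul_left, h]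
      ring
  have := hsum Finset.univ
  rwa [b.sum_repr'] at this

/-- The Rayleigh characterisation, through which the eigenvalue bounds below become inequalities
between quadratic forms. -/
theorem topEig_le_iff (hn : 1 ≤ n) (X : SymMatrix n) (s : ℝ) :
    topEig X ≤ s ↔ ∀ x : EuclideanSpace ℝ (Fin n), bil X x x ≤ s * ‖x‖ ^ 2 := by
  obtain ⟨b, l, hb, hl, i, hi⟩ := exists_eigenbasis hn X
  constructor
  · intro hs x
    rw [bil_self_eq_sum hb, ← b.sum_sq_inner_right x, Finset.mul_sum]
    exact Finset.sum_le_sum fun j _ =>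
      mul_le_mul_of_nonneg_right ((hl j).trans hs) (sq_nonneg _)
  · intro h
    have := h (b i)
    rwa [hb, real_inner_self_eq_norm_sq, b.norm_eq_one, one_pow, mul_one, mul_one, hi] at this

theorem bil_self_le (hn : 1 ≤ n) (X : SymMatrix n) (x : EuclideanSpace ℝ (Fin n)) :
    bil X x x ≤ topEig X * ‖x‖ ^ 2 :=
  (topEig_le_iff hn X _).mp le_rfl x

theorem exists_topEigenvector (hn : 1 ≤ n) (X : SymMatrix n) :
    ∃ v : EuclideanSpace ℝ (Fin n), ‖v‖ = 1 ∧ ∀ y, bil X v y = topEig X * inner ℝ v y := by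
  obtain ⟨b, l, hb, -, i, hi⟩ := exists_eigenbasis hn X
  exact ⟨b i, b.norm_eq_one i, fun y => hi ▸ hb i y⟩

theorem norm_tens (x y : EuclideanSpace ℝ (Fin n)) : ‖tens x y‖ = ‖x‖ * ‖y‖ := by
  rw [← sq_eq_sq₀ (norm_nonneg _) (by positivity), ← real_inner_self_eq_norm_sq, inner_tens_tens,
    real_inner_self_eq_norm_sq, real_inner_self_eq_norm_sq, mul_pow]

theorem abs_bil_self_le (H : SymMatrix n) (x : EuclideanSpace ℝ (Fin n)) :
    |bil H x x| ≤ ‖H‖ * ‖x‖ ^ 2 := by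
  have := abs_real_inner_le_norm (H : EuclideanSpace ℝ (Fin n × Fin n)) (tens x x)
  rwa [norm_tens, ← sq] at this

/-- The gain `1/√2` over Cauchy-Schwarz comes from symmetry: `H` is paired with `v ⊗ y + y ⊗ v`,
whose two terms are orthogonal. It yields the factor `1/2` in the second order term of
`topEig_add_le_of_gap`. -/
theorem abs_bil_le_of_inner_eq_zero (H : SymMatrix n) {v y : EuclideanSpace ℝ (Fin n)}
    (hv : ‖v‖ = 1) (hvy : inner ℝ v y = 0) : |bil H v y| ≤ ‖H‖ / √2 * ‖y‖ := by
  have h1 : 2 * bil H v y = inner ℝ (H : EuclideanSpace ℝ (Fin n × Fin n))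
      (tens v y + tens y v) := by
    rw [inner_add_right]
    change _ = bil H v y + bil H y v
    rw [bil_comm H y v]; ring
  have h2 : ‖tens v y + tens y v‖ = √2 * ‖y‖ := by
    rw [← sq_eq_sq₀ (norm_nonneg _) (by positivity), norm_add_sq_real, inner_tens_tens, norm_tens,
      norm_tens, hv, hvy, mul_pow (√2), Real.sq_sqrt zero_le_two]
    ring
  have h3 := abs_real_inner_le_norm (H : EuclideanSpace ℝ (Fin n × Fin n)) (tens v y + tens y v)
  rw [← h1, h2, abs_mul, abs_two] at h3
  have h4 : ‖H‖ / √2 * ‖y‖ = ‖H‖ * (√2 * ‖y‖) / 2 := by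
    have : √2 * √2 = 2 := Real.mul_self_sqrt zero_le_two
    rw [div_mul_eq_mul_div, div_eq_div_iff (by positivity) two_ne_zero]
    linear_combination (-‖H‖ * ‖y‖) * this
  rw [h4]
  change 2 * |bil H v y| ≤ ‖H‖ * (√2 * ‖y‖) at h3
  linarith

/-- The squared Frobenius norm of `v vᵀ - w wᵀ` is `2 - 2⟪v, w⟫²`, hence at most 2. -/
theorem bil_self_sub_bil_self_le (H : SymMatrix n) {v w : EuclideanSpace ℝ (Fin n)}
    (hv : ‖v‖ = 1) (hw : ‖w‖ = 1) : bil H v v - bil H w w ≤ √2 * ‖H‖ := by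
  have h1 : bil H v v - bil H w w = inner ℝ (H : EuclideanSpace ℝ (Fin n × Fin n))
      (tens v v - tens w w) := by
    rw [inner_sub_right]; rfl
  have h2 : ‖tens v v - tens w w‖ ≤ √2 := by
    refine Real.le_sqrt_of_sq_le ?_
    rw [norm_sub_sq_real, inner_tens_tens, norm_tens, norm_tens, hv, hw]
    nlinarith [mul_self_nonneg (inner ℝ v w)]
  rw [h1, mul_comm]
  exact (real_inner_le_norm _ _).trans (mul_le_mul_of_nonneg_left h2 (norm_nonneg _))

theorem topEig_add_le (hn : 1 ≤ n) (X H : SymMatrix n) : topEig (X + H) ≤ topEig X + ‖H‖ := by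
  rw [topEig_le_iff hn]
  intro x
  rw [bil_add, add_mul]
  exact add_le_add (bil_self_le hn X x) ((le_abs_self _).trans (abs_bil_self_le H x))

theorem topEig_convex_comb_le (hn : 1 ≤ n) (X Y : SymMatrix n) {a b : ℝ} (ha : 0 ≤ a)
    (hb : 0 ≤ b) : topEig (a • X + b • Y) ≤ a * topEig X + b * topEig Y := by
  rw [topEig_le_iff hn]
  intro x
  rw [bil_add, bil_smul, bil_smul, add_mul, mul_assoc, mul_assoc]
  exact add_le_add (mul_le_mul_of_nonneg_left (bil_self_le hn X x) ha)
    (mul_le_mul_of_nonneg_left (bil_self_le hn Y x) hb)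

theorem topEig_le_topEig_add_smul_symTens (hn : 1 ≤ n) (X : SymMatrix n) {c : ℝ} (hc : 0 ≤ c)
    (z : EuclideanSpace ℝ (Fin n)) : topEig X ≤ topEig (X + c • symTens z) := by
  rw [topEig_le_iff hn]
  intro x
  refine le_trans ?_ (bil_self_le hn _ x)
  rw [bil_add, bil_smul, bil_symTens]
  nlinarith [mul_nonneg hc (mul_self_nonneg (inner ℝ z x))]

/-- Interlacing: orthogonally to the top eigenvector of a rank-one perturbation, the perturbed form
is bounded by the largest eigenvalue of the unperturbed matrix. -/
theorem bil_self_le_of_inner_topEigenvector_eq_zero (hn : 1 ≤ n) (X : SymMatrix n) {c : ℝ}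
    {z v : EuclideanSpace ℝ (Fin n)} (hv : ‖v‖ = 1)
    (heig : ∀ y, bil (X + c • symTens z) v y = topEig (X + c • symTens z) * inner ℝ v y)
    (hgap : topEig X < topEig (X + c • symTens z)) {y : EuclideanSpace ℝ (Fin n)}
    (hvy : inner ℝ v y = 0) : bil (X + c • symTens z) y y ≤ topEig X * ‖y‖ ^ 2 := by
  set M := X + c • symTens z with hM
  set φ := topEig M
  have hMX : ∀ x, bil M x x = bil X x x + c * inner ℝ z x ^ 2 := by
    intro x; rw [hM, bil_add, bil_smul, bil_symTens]; ring
  have hvv : bil M v v = φ := by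
    rw [heig, real_inner_self_eq_norm_sq, hv]; ring
  have hvyM : bil M v y = 0 := by rw [heig, hvy, mul_zero]
  have hzv : inner ℝ z v ≠ 0 := by
    intro h0
    have h1 := hMX v
    have h2 := bil_self_le hn X v
    rw [h0, hvv] at h1
    rw [hv] at h2
    linarith
  set p := inner ℝ z v
  set q := inner ℝ z y
  -- A combination orthogonal to `z`, on which the perturbed and the original forms agree. Its `v`
  -- part contributes `q²φ ≥ q² topEig X`, so the bound for `u` passes to `y`.
  set u := q • v + (-p) • y with hu
  have huz : inner ℝ z u = 0 := by
    rw [hu, inner_add_right, inner_smul_right, inner_smul_right]; ring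
  have hun : ‖u‖ ^ 2 = q ^ 2 + p ^ 2 * ‖y‖ ^ 2 := by
    rw [hu, norm_add_sq_real, norm_smul, norm_smul, inner_smul_left, inner_smul_right, hvy, hv,
      Real.norm_eq_abs, Real.norm_eq_abs, mul_pow, mul_pow, sq_abs, sq_abs]
    ring
  have huM : bil M u u = q ^ 2 * φ + p ^ 2 * bil M y y := by
    rw [hu, bil_add_left, bil_add_right, bil_add_right, bil_smul_left, bil_smul_left,
      bil_smul_left, bil_smul_left, bil_smul_right, bil_smul_right, bil_smul_right,
      bil_smul_right, bil_comm M y v, hvyM, hvv]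
    ring
  have h1 := hMX u
  have h2 := bil_self_le hn X u
  rw [huz, huM] at h1
  rw [hun] at h2
  have hp : 0 < p ^ 2 := by positivity
  have h3 : p ^ 2 * bil M y y ≤ p ^ 2 * (topEig X * ‖y‖ ^ 2) := by
    nlinarith [mul_nonneg (sq_nonneg q) (sub_nonneg.mpr hgap.le)]
  exact le_of_mul_le_mul_left h3 hp

/-- Second order upper bound for the largest eigenvalue above a spectral gap. -/
theorem topEig_add_le_of_gap (hn : 1 ≤ n) (M H : SymMatrix n) {φ l : ℝ}
    {v : EuclideanSpace ℝ (Fin n)} (hv : ‖v‖ = 1) (heig : ∀ y, bil M v y = φ * inner ℝ v y)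
    (hgap : ∀ y, inner ℝ v y = 0 → bil M y y ≤ l * ‖y‖ ^ 2) (hH : 2 * ‖H‖ < φ - l) :
    topEig (M + H) ≤ φ + bil H v v + ‖H‖ ^ 2 / 2 / (φ - l - 2 * ‖H‖) := by
  set τ := ‖H‖ with hτ
  -- `D` is the room left in the coefficient of `‖y‖²` after the gap and the diagonal terms of `H`,
  -- each at most `τ`; `e` is chosen with `e D = τ²/2`, so that AM-GM absorbs the cross term.
  set D := φ - l - 2 * τ with hD
  have hD0 : 0 < D := by linarith
  set e := τ ^ 2 / 2 / D with he
  have heD : e * D = τ ^ 2 / 2 := div_mul_cancel₀ _ hD0.ne'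
  have he0 : 0 ≤ e := by positivity
  rw [topEig_le_iff hn]
  intro x
  set α := inner ℝ v x with hα
  set y := x - α • v with hy
  have hvy : inner ℝ v y = 0 := by
    rw [hy, inner_sub_right, inner_smul_right, real_inner_self_eq_norm_sq, hv]
    ring
  have hx : x = α • v + y := by rw [hy]; abel
  have hxn : ‖x‖ ^ 2 = α ^ 2 + ‖y‖ ^ 2 := by
    rw [hx, norm_add_sq_real, norm_smul, inner_smul_left, hvy, hv, Real.norm_eq_abs, mul_pow,
      sq_abs]
    ring
  have hexp : ∀ W : SymMatrix n,
      bil W x x = α ^ 2 * bil W v v + 2 * α * bil W v y + bil W y y := by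
    intro W
    rw [hx, bil_add_left, bil_add_right, bil_add_right, bil_smul_left, bil_smul_left,
      bil_smul_right, bil_smul_right, bil_comm W y v]
    ring
  have hMvv : bil M v v = φ := by rw [heig, real_inner_self_eq_norm_sq, hv]; ring
  have hMvy : bil M v y = 0 := by rw [heig, hvy, mul_zero]
  have hMyy := hgap y hvy
  have hHvv := abs_le.mp (abs_bil_self_le H v)
  have hHyy := (le_abs_self _).trans (abs_bil_self_le H y)
  have hHvy := abs_bil_le_of_inner_eq_zero H hv hvy
  rw [hv] at hHvv
  set s := τ / √2 with hs
  have hs2 : s ^ 2 = τ ^ 2 / 2 := by rw [hs, div_pow, Real.sq_sqrt zero_le_two]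
  have hs0 : 0 ≤ s := by positivity
  have hcross : 2 * α * bil H v y ≤ e * α ^ 2 + D * ‖y‖ ^ 2 := by
    have h1 : α * bil H v y ≤ |α| * (s * ‖y‖) := by
      calc α * bil H v y ≤ |α * bil H v y| := le_abs_self _
        _ = |α| * |bil H v y| := abs_mul _ _
        _ ≤ _ := mul_le_mul_of_nonneg_left hHvy (abs_nonneg _)
    have h2 : D * (2 * (|α| * (s * ‖y‖))) ≤ D * (e * α ^ 2 + D * ‖y‖ ^ 2) := by
      have h3 := sq_nonneg (s * |α| - D * ‖y‖)
      have h4 : D * (e * α ^ 2) = s ^ 2 * |α| ^ 2 := by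
        rw [sq_abs, hs2, ← heD]; ring
      nlinarith
    have h5 := le_of_mul_le_mul_left h2 hD0
    linarith
  rw [bil_add, hexp M, hexp H, hMvv, hMvy, hxn]
  have hy0 := sq_nonneg ‖y‖
  have h6 : bil M y y + bil H y y ≤ (l + τ) * ‖y‖ ^ 2 := by linarith
  have h7 : 0 ≤ (φ + bil H v v + e - l - τ - D) * ‖y‖ ^ 2 :=
    mul_nonneg (by rw [hD]; linarith [hHvv.1]) hy0
  nlinarith

end SymmetricMatrices

/-! ### Second differences of the maximum and of its expectation. -/

noncomputable section Smoothing

variable {n k : ℕ}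

theorem lipschitzWith_topEig (hn : 1 ≤ n) : LipschitzWith 1 (topEig (n := n)) := by
  refine LipschitzWith.of_le_add fun X Y => ?_
  have := topEig_add_le hn Y (X - Y)
  rwa [add_sub_cancel, ← dist_eq_norm] at this

theorem continuous_symTens : Continuous (symTens (n := n)) := by
  unfold symTens tens
  refine Continuous.subtype_mk ?_ _
  fun_prop

/-- The normalized increase of the largest eigenvalue under a rank-one perturbation. -/
def eigIncrease (c : ℝ) (X : SymMatrix n) (z : EuclideanSpace ℝ (Fin n)) : ℝ :=
  (topEig (X + c • symTens z) - topEig X) / c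

theorem measurable_eigIncrease (hn : 1 ≤ n) (c : ℝ) (X : SymMatrix n) :
    Measurable (eigIncrease c X) := by
  have h1 := continuous_symTens (n := n)
  have h2 := (lipschitzWith_topEig hn).continuous
  unfold eigIncrease
  have : Continuous fun z : EuclideanSpace ℝ (Fin n) =>
      (topEig (X + c • symTens z) - topEig X) / c := by fun_prop
  exact this.measurable

theorem topEig_add_smul_symTens {c : ℝ} (hc : 0 < c) (X : SymMatrix n)
    (z : EuclideanSpace ℝ (Fin n)) :
    topEig (X + c • symTens z) = topEig X + c * eigIncrease c X z := by
  rw [eigIncrease, mul_div_cancel₀ _ hc.ne']; ring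

/-- The secular equation: in an eigenbasis of `X`, the increase of the largest eigenvalue is the
largest root of the secular function. -/
theorem eigIncrease_le_iff_secular_le (hn : 1 ≤ n) {c : ℝ} (hc : 0 < c) {X : SymMatrix n}
    {b : OrthonormalBasis (Fin n) ℝ (EuclideanSpace ℝ (Fin n))} {l : Fin n → ℝ}
    (hb : ∀ j y, bil X (b j) y = l j * inner ℝ (b j) y) (hl : ∀ j, l j ≤ topEig X)
    (y : Fin n → ℝ) {t : ℝ} (ht : 0 < t) :
    eigIncrease c X (∑ j, y j • b j) ≤ t ↔ secular (fun j => (topEig X - l j) / c) y t ≤ 1 := by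
  set d : Fin n → ℝ := fun j => t + (topEig X - l j) / c with hd
  have hd0 : ∀ j, 0 < d j := fun j => by
    have := div_nonneg (sub_nonneg.mpr (hl j)) hc.le
    simp only [hd]; linarith
  have hcd : ∀ j, c * d j = topEig X + c * t - l j := by
    intro j; simp only [hd]; field_simp; ring
  have hquad : (∀ x : EuclideanSpace ℝ (Fin n),
      bil (X + c • symTens (∑ j, y j • b j)) x x ≤ (topEig X + c * t) * ‖x‖ ^ 2) ↔
      ∀ u : Fin n → ℝ, (∑ j, y j * u j) ^ 2 ≤ ∑ j, d j * u j ^ 2 := by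
    have key : ∀ x : EuclideanSpace ℝ (Fin n),
        (bil (X + c • symTens (∑ j, y j • b j)) x x ≤ (topEig X + c * t) * ‖x‖ ^ 2) ↔
        (∑ j, y j * inner ℝ (b j) x) ^ 2 ≤ ∑ j, d j * inner ℝ (b j) x ^ 2 := by
      intro x
      have hin : inner ℝ (∑ j, y j • b j) x = ∑ j, y j * inner ℝ (b j) x := by
        rw [sum_inner]
        exact Finset.sum_congr rfl fun j _ => by rw [inner_smul_left]; simp
      rw [bil_add, bil_smul, bil_symTens, hin, bil_self_eq_sum hb, ← b.sum_sq_inner_right x]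
      have e : c * ∑ j, d j * inner ℝ (b j) x ^ 2 =
          (topEig X + c * t) * ∑ j, inner ℝ (b j) x ^ 2 - ∑ j, l j * inner ℝ (b j) x ^ 2 := by
        rw [Finset.mul_sum, Finset.mul_sum, ← Finset.sum_sub_distrib]
        exact Finset.sum_congr rfl fun j _ => by rw [← mul_assoc, hcd]; ring
      constructor
      · intro h
        refine le_of_mul_le_mul_left ?_ hc
        rw [e]; nlinarith
      · intro h
        have := mul_le_mul_of_nonneg_left h hc.le
        rw [e] at this; nlinarith
    constructor
    · intro h u
      have := (key (∑ j, u j • b j)).mp (h _)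
      simpa [b.orthonormal.inner_right_fintype] using this
    · exact fun h x => (key x).mpr (h _)
  have hiff : eigIncrease c X (∑ j, y j • b j) ≤ t ↔
      topEig (X + c • symTens (∑ j, y j • b j)) ≤ topEig X + c * t := by
    rw [eigIncrease, div_le_iff₀ hc]
    constructor <;> intro h <;> linarith
  rw [hiff, topEig_le_iff hn, hquad]
  change _ ↔ ∑ j, y j ^ 2 / d j ≤ 1
  constructor
  · intro h
    -- The extremal vector of Cauchy-Schwarz with weights `d`; the converse is Cauchy-Schwarz
    -- itself.
    have h1 := h fun j => y j / d j
    have e1 : ∑ j, y j * (y j / d j) = ∑ j, y j ^ 2 / d j :=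
      Finset.sum_congr rfl fun j _ => by ring
    have e2 : ∑ j, d j * (y j / d j) ^ 2 = ∑ j, y j ^ 2 / d j :=
      Finset.sum_congr rfl fun j _ => by
        have := (hd0 j).ne'
        field_simp
    rw [e1, e2] at h1
    by_contra h2
    push Not at h2
    nlinarith
  · intro h u
    have h1 := Finset.sum_sq_le_sum_mul_sum_of_sq_le_mul Finset.univ
      (r := fun j => y j * u j) (f := fun j => y j ^ 2 / d j) (g := fun j => d j * u j ^ 2)
      (fun j _ => div_nonneg (sq_nonneg _) (hd0 j).le)
      (fun j _ => mul_nonneg (hd0 j).le (sq_nonneg _))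
      (fun j _ => by have := (hd0 j).ne'; exact le_of_eq (by field_simp))
    have h2 : 0 ≤ ∑ j, d j * u j ^ 2 :=
      Finset.sum_nonneg fun j _ => mul_nonneg (hd0 j).le (sq_nonneg _)
    exact h1.trans (mul_le_of_le_one_left h2 h)

theorem dominatesChiSq_map_eigIncrease (hn : 1 ≤ n) {c : ℝ} (hc : 0 < c) (X : SymMatrix n) :
    DominatesChiSq ((stdGaussian (EuclideanSpace ℝ (Fin n))).map (eigIncrease c X)) := by
  obtain ⟨b, l, hb, hl, i, hi⟩ := exists_eigenbasis hn X
  have hm : Measurable fun x : Fin n → ℝ => ∑ j, x j • b j := by fun_prop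
  rw [stdGaussian_eq_map_pi_orthonormalBasis b, Measure.map_map (measurable_eigIncrease hn c X) hm]
  exact dominatesChiSq_map_secularRoot (L := fun j => (topEig X - l j) / c)
    (fun j => div_nonneg (sub_nonneg.mpr (hl j)) hc.le) (i := i) (by simp [hi])
    ((measurable_eigIncrease hn c X).comp hm)
    fun y t ht => eigIncrease_le_iff_secular_le hn hc hb hl y ht

/-- The largest of the top eigenvalues of `k` rank-one perturbations. -/
def maxTopEig (c : ℝ) (ζ : Fin k → EuclideanSpace ℝ (Fin n)) (X : SymMatrix n) : ℝ :=
  ⨆ i, topEig (X + c • symTens (ζ i))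

theorem maxPerturbed_eq_maxTopEig (ε : ℝ) (ζ : Fin k → EuclideanSpace ℝ (Fin n))
    (X : SymMatrix n) : maxPerturbed ε ζ X = maxTopEig (ε / n) ζ X := by
  simp only [maxPerturbed, maxTopEig, topEig, symToMatrix_add_smul_symTens]

theorem topEig_le_maxTopEig (c : ℝ) (ζ : Fin k → EuclideanSpace ℝ (Fin n)) (X : SymMatrix n)
    (i : Fin k) : topEig (X + c • symTens (ζ i)) ≤ maxTopEig c ζ X :=
  le_ciSup (f := fun i => topEig (X + c • symTens (ζ i))) (finite_range _).bddAbove i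

theorem exists_topEig_eq_maxTopEig (hk : 2 ≤ k) (c : ℝ) (ζ : Fin k → EuclideanSpace ℝ (Fin n))
    (X : SymMatrix n) : ∃ i, topEig (X + c • symTens (ζ i)) = maxTopEig c ζ X := by
  have : Nonempty (Fin k) := ⟨⟨0, by lia⟩⟩
  exact exists_eq_ciSup_of_finite (f := fun i => topEig (X + c • symTens (ζ i)))

theorem maxTopEig_add_le (hn : 1 ≤ n) (hk : 2 ≤ k) (c : ℝ)
    (ζ : Fin k → EuclideanSpace ℝ (Fin n)) (X H : SymMatrix n) :
    maxTopEig c ζ (X + H) ≤ maxTopEig c ζ X + ‖H‖ := by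
  have : Nonempty (Fin k) := ⟨⟨0, by lia⟩⟩
  refine ciSup_le fun i => ?_
  rw [add_right_comm]
  exact (topEig_add_le hn _ H).trans (by linarith [topEig_le_maxTopEig c ζ X i])

theorem maxTopEig_convex_comb_le (hn : 1 ≤ n) (hk : 2 ≤ k) (c : ℝ)
    (ζ : Fin k → EuclideanSpace ℝ (Fin n)) (X Y : SymMatrix n) {a b : ℝ} (ha : 0 ≤ a)
    (hb : 0 ≤ b) (hab : a + b = 1) :
    maxTopEig c ζ (a • X + b • Y) ≤ a * maxTopEig c ζ X + b * maxTopEig c ζ Y := by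
  have : Nonempty (Fin k) := ⟨⟨0, by lia⟩⟩
  refine ciSup_le fun i => ?_
  have e : a • X + b • Y + c • symTens (ζ i) =
      a • (X + c • symTens (ζ i)) + b • (Y + c • symTens (ζ i)) := by
    have : c • symTens (ζ i) = (a + b) • (c • symTens (ζ i)) := by rw [hab, one_smul]
    conv_lhs => rw [this]
    module
  rw [e]
  exact (topEig_convex_comb_le hn _ _ ha hb).trans (add_le_add
    (mul_le_mul_of_nonneg_left (topEig_le_maxTopEig c ζ X i) ha)
    (mul_le_mul_of_nonneg_left (topEig_le_maxTopEig c ζ Y i) hb))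

theorem maxTopEig_eq (hk : 2 ≤ k) {c : ℝ} (hc : 0 < c) (ζ : Fin k → EuclideanSpace ℝ (Fin n))
    (X : SymMatrix n) :
    maxTopEig c ζ X = topEig X + c * ⨆ i, eigIncrease c X (ζ i) := by
  have : Nonempty (Fin k) := ⟨⟨0, by lia⟩⟩
  have hbdd : BddAbove (range fun i => eigIncrease c X (ζ i)) := (finite_range _).bddAbove
  refine le_antisymm (ciSup_le fun i => ?_) ?_
  · rw [topEig_add_smul_symTens hc]
    have := mul_le_mul_of_nonneg_left (le_ciSup hbdd i) hc.le
    linarith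
  · obtain ⟨i, hi⟩ := exists_eq_ciSup_of_finite (f := fun i => eigIncrease c X (ζ i))
    rw [← hi, ← topEig_add_smul_symTens hc]
    exact topEig_le_maxTopEig c ζ X i

/-- The second difference of the maximum, away from small gaps above the largest eigenvalue. -/
theorem maxTopEig_second_difference_le (hn : 1 ≤ n) (hk : 2 ≤ k) {c : ℝ} (hc : 0 < c)
    (ζ : Fin k → EuclideanSpace ℝ (Fin n)) (X H : SymMatrix n)
    (hgap : 4 * ‖H‖ < c * ⨆ i, eigIncrease c X (ζ i)) :
    ∃ i, othersMax (fun j => eigIncrease c X (ζ j)) i ≤ eigIncrease c X (ζ i) ∧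
      maxTopEig c ζ (X + H) + maxTopEig c ζ (X - H) - 2 * maxTopEig c ζ X ≤
        c * max (√2 * ‖H‖ / c - (eigIncrease c X (ζ i) -
          othersMax (fun j => eigIncrease c X (ζ j)) i)) 0 +
        ‖H‖ ^ 2 / (c * (⨆ i, eigIncrease c X (ζ i)) - 4 * ‖H‖) := by
  set T : Fin k → ℝ := fun j => eigIncrease c X (ζ j) with hT
  set τ := ‖H‖ with hτ
  have hτ0 : 0 ≤ τ := norm_nonneg H
  set m := c * ⨆ i, T i with hm
  have hS : maxTopEig c ζ X = topEig X + m := maxTopEig_eq hk hc ζ X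
  have hφ : ∀ i, topEig (X + c • symTens (ζ i)) = topEig X + c * T i :=
    fun i => topEig_add_smul_symTens hc X (ζ i)
  have hTm : ∀ i, c * T i ≤ m := by
    intro i
    have := topEig_le_maxTopEig c ζ X i
    rw [hφ, hS] at this
    linarith
  choose v hv heig using fun i => exists_topEigenvector hn (X + c • symTens (ζ i))
  have hD : 0 < m - 4 * τ := by linarith
  -- An index maximal at `X + K` need not be maximal at `X`, but it is within `2τ` of it since each
  -- eigenvalue moves by at most `τ`. Its spectral gap is thus at least `m - 2τ`, and the expansion
  -- costs another `2τ`, whence `m - 4τ`.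
  have hbound : ∀ K : SymMatrix n, ‖K‖ = τ → ∃ i, maxTopEig c ζ (X + K) ≤
      topEig X + c * T i + bil K (v i) (v i) + τ ^ 2 / 2 / (m - 4 * τ) := by
    intro K hK
    obtain ⟨i, hi⟩ := exists_topEig_eq_maxTopEig hk c ζ (X + K)
    rw [add_right_comm] at hi
    have h1 : maxTopEig c ζ X ≤ maxTopEig c ζ (X + K) + τ := by
      have := maxTopEig_add_le hn hk c ζ (X + K) (-K)
      rwa [add_neg_cancel_right, norm_neg, hK] at this
    have h2 := topEig_add_le hn (X + c • symTens (ζ i)) K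
    rw [hi, hφ, hK] at h2
    have h3 : m - 2 * τ ≤ c * T i := by linarith
    have h4 : topEig X < topEig (X + c • symTens (ζ i)) := by rw [hφ]; linarith
    have h5 := topEig_add_le_of_gap hn (X + c • symTens (ζ i)) K (hv i) (heig i)
      (fun y hy => bil_self_le_of_inner_topEigenvector_eq_zero hn X (hv i) (heig i) h4 hy)
      (by rw [hφ, hK]; linarith)
    rw [hi, hφ, hK] at h5
    have h6 : τ ^ 2 / 2 / (topEig X + c * T i - topEig X - 2 * τ) ≤ τ ^ 2 / 2 / (m - 4 * τ) :=
      div_le_div_of_nonneg_left (by positivity) hD (by linarith)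
    exact ⟨i, by linarith⟩
  obtain ⟨a, ha⟩ := hbound H rfl
  obtain ⟨b, hb⟩ := hbound (-H) (norm_neg H)
  rw [← sub_eq_add_neg, bil_neg] at hb
  have hne : Nonempty (Fin k) := ⟨a⟩
  obtain ⟨i, hi⟩ := exists_eq_ciSup_of_finite (f := T)
  have hTi : ∀ j, T j ≤ T i := fun j => by
    rw [hi]; exact le_ciSup (f := T) (finite_range _).bddAbove j
  have him : c * T i = m := by rw [hi]
  have hhalf : τ ^ 2 / (m - 4 * τ) = 2 * (τ ^ 2 / 2 / (m - 4 * τ)) := by ring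
  refine ⟨i, ?_, ?_⟩
  · obtain ⟨j, -, hj⟩ := exists_eq_othersMax hk T i
    rw [← hj]; exact hTi j
  rw [hS, hhalf]
  have hmax0 : 0 ≤ c * max (√2 * τ / c - (T i - othersMax T i)) 0 :=
    mul_nonneg hc.le (le_max_right _ _)
  have hmax1 : √2 * τ - m + c * othersMax T i ≤
      c * max (√2 * τ / c - (T i - othersMax T i)) 0 := by
    refine le_trans (le_of_eq ?_) (mul_le_mul_of_nonneg_left (le_max_left _ _) hc.le)
    rw [← him]
    field_simp
    ring
  -- For equal indices the linear terms in `H` cancel. For distinct ones they leave at most `√2 τ`,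
  -- but at least one of the two indices is not `i`, so one eigenvalue is at most the runner-up.
  by_cases hab : a = b
  · rw [← hab] at hb
    linarith [hTm a]
  · have hdiff := bil_self_sub_bil_self_le H (hv a) (hv b)
    have hsum : c * T a + c * T b ≤ m + c * othersMax T i := by
      by_cases hai : a = i
      · have := mul_le_mul_of_nonneg_left (le_othersMax T (i := i) (j := b)
          (fun h => hab (hai.trans h.symm))) hc.le
        linarith [hTm a]
      · have := mul_le_mul_of_nonneg_left (le_othersMax T hai) hc.le
        linarith [hTm b]
    linarith

/-- The coefficient of the second order remainder at scale `τ`. -/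
def remainderCoeff (σ m τ : ℝ) : ℝ :=
  if 8 * (τ * σ) ≤ m then σ ^ 2 / (m - 4 * (τ * σ)) else 2 * σ / τ

/-- An integrable majorant independent of `τ`, for dominated convergence. The constant 16 comes from
the second branch, where `1/τ < 8σ/m`. -/
theorem remainderCoeff_le {σ m τ : ℝ} (hσ : 0 ≤ σ) (hm : 0 < m) (hτ : 0 < τ) :
    remainderCoeff σ m τ ≤ 16 * σ ^ 2 * m⁻¹ := by
  have hτσ : 0 ≤ τ * σ := by positivity
  rw [← div_eq_mul_inv]
  unfold remainderCoeff
  split_ifs with h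
  · rw [div_le_div_iff₀ (by linarith) hm]
    nlinarith [sq_nonneg σ]
  · push Not at h
    rw [div_le_div_iff₀ hτ hm]
    nlinarith

theorem tendsto_remainderCoeff {σ m : ℝ} (hm : 0 < m) :
    Tendsto (fun τ => remainderCoeff σ m τ) (𝓝[>] 0) (𝓝 (σ ^ 2 * m⁻¹)) := by
  have h1 : Tendsto (fun τ : ℝ => σ ^ 2 / (m - 4 * (τ * σ))) (𝓝[>] 0)
      (𝓝 (σ ^ 2 / (m - 4 * (0 * σ)))) := by
    refine Tendsto.mono_left ?_ nhdsWithin_le_nhds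
    refine ContinuousAt.tendsto (f := fun τ : ℝ => σ ^ 2 / (m - 4 * (τ * σ))) ?_
    refine ContinuousAt.div (by fun_prop) (by fun_prop) (by simpa using hm.ne')
  rw [zero_mul, mul_zero, sub_zero, div_eq_mul_inv] at h1
  refine h1.congr' ?_
  have h2 : ∀ᶠ τ in 𝓝[>] (0 : ℝ), 8 * (τ * σ) < m := by
    refine nhdsWithin_le_nhds ?_
    have : Continuous fun τ : ℝ => 8 * (τ * σ) := by fun_prop
    exact this.continuousAt.eventually_lt continuousAt_const (by simpa using hm)
  filter_upwards [h2] with τ hτ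
  rw [remainderCoeff, if_pos hτ.le]

theorem measurable_remainderCoeff (σ τ : ℝ) : Measurable fun m => remainderCoeff σ m τ := by
  unfold remainderCoeff
  exact Measurable.ite measurableSet_Ici (by fun_prop) measurable_const

theorem hasLaw_eigIncrease {Ω : Type*} [MeasurableSpace Ω] {μ : Measure Ω}
    {z : Fin k → Ω → EuclideanSpace ℝ (Fin n)} (hn : 1 ≤ n) (c : ℝ) (X : SymMatrix n)
    (hlaw : ∀ i, HasLaw (z i) (stdGaussian (EuclideanSpace ℝ (Fin n))) μ) (i : Fin k) :
    HasLaw (fun ω => eigIncrease c X (z i ω))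
      ((stdGaussian (EuclideanSpace ℝ (Fin n))).map (eigIncrease c X)) μ :=
  HasLaw.fun_comp ⟨(measurable_eigIncrease hn c X).aemeasurable, rfl⟩ (hlaw i)

variable {Ω : Type*} [MeasurableSpace Ω] {μ : Measure Ω} [IsProbabilityMeasure μ]
  {z : Fin k → Ω → EuclideanSpace ℝ (Fin n)}

theorem norm_symTens (x : EuclideanSpace ℝ (Fin n)) : ‖symTens x‖ = ‖x‖ ^ 2 := by
  change ‖tens x x‖ = _
  rw [norm_tens, sq]

theorem abs_maxTopEig_le (hn : 1 ≤ n) (hk : 2 ≤ k) {c : ℝ} (hc : 0 < c)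
    (ζ : Fin k → EuclideanSpace ℝ (Fin n)) (X : SymMatrix n) :
    |maxTopEig c ζ X| ≤ |topEig X| + c * ∑ i, ‖ζ i‖ ^ 2 := by
  have hne : Nonempty (Fin k) := ⟨⟨0, by lia⟩⟩
  have h1 : topEig X ≤ maxTopEig c ζ X :=
    (topEig_le_topEig_add_smul_symTens hn X hc.le (ζ ⟨0, by lia⟩)).trans
      (topEig_le_maxTopEig c ζ X _)
  have h2 : maxTopEig c ζ X ≤ topEig X + c * ∑ i, ‖ζ i‖ ^ 2 := by
    refine ciSup_le fun i => (topEig_add_le hn X _).trans ?_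
    rw [norm_smul, Real.norm_of_nonneg hc.le, norm_symTens]
    have := Finset.single_le_sum (f := fun i => ‖ζ i‖ ^ 2) (fun i _ => sq_nonneg _)
      (Finset.mem_univ i)
    gcongr
  have h3 : 0 ≤ c * ∑ i, ‖ζ i‖ ^ 2 := by positivity
  rw [abs_le]
  constructor <;> linarith [neg_abs_le (topEig X), le_abs_self (topEig X)]

theorem integrable_maxTopEig (hn : 1 ≤ n) (hk : 2 ≤ k) {c : ℝ} (hc : 0 < c)
    (hlaw : ∀ i, HasLaw (z i) (stdGaussian (EuclideanSpace ℝ (Fin n))) μ) (X : SymMatrix n) :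
    Integrable (fun ω => maxTopEig c (fun i => z i ω) X) μ := by
  have hzsq : ∀ i, Integrable (fun ω => ‖z i ω‖ ^ 2) μ := by
    intro i
    have h1 := (IsGaussian.memLp_two_id (μ := stdGaussian (EuclideanSpace ℝ (Fin n))))
    rw [← (hlaw i).map_eq] at h1
    have h2 := (memLp_map_measure_iff (by fun_prop) (hlaw i).aemeasurable).mp h1
    exact h2.integrable_norm_pow two_ne_zero
  have hm : AEMeasurable (fun ω => maxTopEig c (fun i => z i ω) X) μ := by
    refine AEMeasurable.iSup fun i => ?_
    have h1 := continuous_symTens (n := n)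
    have h2 := (lipschitzWith_topEig hn).continuous
    have h3 : Continuous fun x : EuclideanSpace ℝ (Fin n) => topEig (X + c • symTens x) := by
      fun_prop
    exact h3.measurable.comp_aemeasurable (hlaw i).aemeasurable
  refine Integrable.mono' (g := fun ω => |topEig X| + c * ∑ i, ‖z i ω‖ ^ 2) ?_
    hm.aestronglyMeasurable (Eventually.of_forall fun ω => ?_)
  · exact (integrable_const _).add ((integrable_finsetSum _ fun i _ => hzsq i).const_mul c)
  · exact abs_maxTopEig_le hn hk hc _ X

/-- The pointwise second difference, in a form ready for integration. -/
theorem ofReal_second_difference_le (hn : 1 ≤ n) (hk : 2 ≤ k) {c : ℝ} (hc : 0 < c)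
    (ζ : Fin k → EuclideanSpace ℝ (Fin n)) (X V : SymMatrix n) {τ : ℝ} (hτ : 0 < τ)
    (hT : 0 < ⨆ i, eigIncrease c X (ζ i)) :
    ENNReal.ofReal (maxTopEig c ζ (X + τ • V) + maxTopEig c ζ (X - τ • V)
        - 2 * maxTopEig c ζ X) ≤
      ENNReal.ofReal c * (∑ i, {t : Fin k → ℝ | othersMax t i ≤ t i}.indicator
        (fun t => ENNReal.ofReal (√2 * (τ * ‖V‖) / c - (t i - othersMax t i)))
          (fun j => eigIncrease c X (ζ j))) +
      ENNReal.ofReal (τ ^ 2) *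
        ENNReal.ofReal (remainderCoeff ‖V‖ (c * ⨆ i, eigIncrease c X (ζ i)) τ) := by
  set T : Fin k → ℝ := fun j => eigIncrease c X (ζ j) with hTdef
  have hnorm : ‖τ • V‖ = τ * ‖V‖ := by rw [norm_smul, Real.norm_of_nonneg hτ.le]
  rw [← ENNReal.ofReal_mul (sq_nonneg τ), remainderCoeff]
  split_ifs with h
  · have hm : 0 < c * ⨆ i, T i := mul_pos hc hT
    have hτV : 0 ≤ τ * ‖V‖ := by positivity
    obtain ⟨i, hi, hle⟩ := maxTopEig_second_difference_le hn hk hc ζ X (τ • V)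
      (by rw [hnorm]; change _ < c * ⨆ i, T i; linarith)
    rw [hnorm] at hle
    refine (ENNReal.ofReal_le_ofReal hle).trans (ENNReal.ofReal_add_le.trans (add_le_add ?_ ?_))
    · rw [ENNReal.ofReal_mul hc.le]
      refine mul_le_mul' le_rfl ?_
      refine le_trans (le_of_eq ?_) (Finset.single_le_sum
        (f := fun i => {t : Fin k → ℝ | othersMax t i ≤ t i}.indicator
          (fun t => ENNReal.ofReal (√2 * (τ * ‖V‖) / c - (t i - othersMax t i))) T)
        (fun _ _ => zero_le) (Finset.mem_univ i))
      rw [indicator_of_mem (show T ∈ {t : Fin k → ℝ | othersMax t i ≤ t i} from hi),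
        ENNReal.ofReal_max, ENNReal.ofReal_zero, max_eq_left zero_le]
    · refine ENNReal.ofReal_le_ofReal (le_of_eq ?_)
      rw [mul_pow, mul_div_assoc]
  -- When the gap is too small for the expansion, the 1-Lipschitz bound `2τ‖V‖` is used; this is the
  -- other branch of `remainderCoeff`.
  · refine le_trans (ENNReal.ofReal_le_ofReal ?_) le_add_self
    have h1 := maxTopEig_add_le hn hk c ζ X (τ • V)
    have h2 := maxTopEig_add_le hn hk c ζ X (-(τ • V))
    rw [norm_neg, ← sub_eq_add_neg] at h2
    rw [hnorm] at h1 h2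
    have : τ ^ 2 * (2 * ‖V‖ / τ) = 2 * (τ * ‖V‖) := by field_simp
    linarith

/-- The gap term is bounded by an exact multiple of `τ²` at every scale. Only the perturbative
remainder needs a limit, and it absorbs `δ`. -/
theorem eventually_second_difference_le (hn : 1 ≤ n) (hk : 3 ≤ k) {c : ℝ} (hc : 0 < c)
    (hlaw : ∀ i, HasLaw (z i) (stdGaussian (EuclideanSpace ℝ (Fin n))) μ)
    (hindep : iIndepFun z μ) (X V : SymMatrix n) {δ : ℝ} (hδ : 0 < δ) :
    ∀ᶠ τ in 𝓝[>] (0 : ℝ),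
      (∫ ω, maxTopEig c (fun i => z i ω) (X + τ • V) ∂μ) +
        (∫ ω, maxTopEig c (fun i => z i ω) (X - τ • V) ∂μ) -
        2 * (∫ ω, maxTopEig c (fun i => z i ω) X ∂μ) ≤
      ((k : ℝ) / (k - 2) * c⁻¹ * ‖V‖ ^ 2 + δ) * τ ^ 2 := by
  have hk2 : 2 ≤ k := by lia
  have hne : Nonempty (Fin k) := ⟨⟨0, by lia⟩⟩
  set T : Fin k → Ω → ℝ := fun i ω => eigIncrease c X (z i ω) with hT
  have hν := dominatesChiSq_map_eigIncrease hn hc X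
  have hTlaw := hasLaw_eigIncrease hn c X hlaw
  have hTind : iIndepFun T μ := hindep.comp (fun _ => eigIncrease c X)
    fun _ => measurable_eigIncrease hn c X
  have hTm : ∀ i, AEMeasurable (T i) μ := fun i => (hTlaw i).aemeasurable
  have hsupm : AEMeasurable (fun ω => ⨆ i, T i ω) μ := AEMeasurable.iSup hTm
  set κ : ℝ := ((k : ℝ) + 2) / (3 * ((k : ℝ) - 2)) with hκ
  have hk3 : (3 : ℝ) ≤ k := by exact_mod_cast hk
  have hκ0 : 0 ≤ κ := div_nonneg (by linarith) (by linarith)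
  have hinv : ∫⁻ ω, ENNReal.ofReal (⨆ i, T i ω)⁻¹ ∂μ ≤ ENNReal.ofReal κ :=
    lintegral_inv_iSup_le hk hν hTlaw hTind
  have hpos : ∀ᵐ ω ∂μ, 0 < ⨆ i, T i ω := by
    have h0 : ∀ᵐ ω ∂μ, 0 < T ⟨0, by lia⟩ ω := by
      rw [ae_iff]
      have := (hTlaw ⟨0, by lia⟩).map_eq ▸ hν.measure_Iic_zero
      rw [Measure.map_apply_of_aemeasurable (hTm _) measurableSet_Iic] at this
      simpa [preimage, Iic] using this
    filter_upwards [h0] with ω hω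
    exact hω.trans_le (le_ciSup (f := fun i => T i ω) (finite_range _).bddAbove _)
  set σ := ‖V‖ with hσ
  have hrem : Tendsto (fun τ => ∫⁻ ω, ENNReal.ofReal (remainderCoeff σ (c * ⨆ i, T i ω) τ) ∂μ)
      (𝓝[>] 0) (𝓝 (∫⁻ ω, ENNReal.ofReal (σ ^ 2 * (c * ⨆ i, T i ω)⁻¹) ∂μ)) := by
    refine tendsto_lintegral_filter_of_dominated_convergence'
      (fun ω => ENNReal.ofReal (16 * σ ^ 2 * (c * ⨆ i, T i ω)⁻¹)) ?_ ?_ ?_ ?_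
    · exact Eventually.of_forall fun τ => ((measurable_remainderCoeff σ τ).comp_aemeasurable
        (hsupm.const_mul c)).ennreal_ofReal
    · filter_upwards [self_mem_nhdsWithin] with τ hτ
      filter_upwards [hpos] with ω hω
      exact ENNReal.ofReal_le_ofReal
        (remainderCoeff_le (norm_nonneg V) (mul_pos hc hω) hτ)
    · have : ∀ ω, ENNReal.ofReal (16 * σ ^ 2 * (c * ⨆ i, T i ω)⁻¹) =
          ENNReal.ofReal (16 * σ ^ 2 * c⁻¹) * ENNReal.ofReal (⨆ i, T i ω)⁻¹ := by
        intro ω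
        rw [← ENNReal.ofReal_mul (by positivity), mul_inv, mul_assoc (16 * σ ^ 2)]
      simp_rw [this]
      rw [lintegral_const_mul' _ _ ENNReal.ofReal_ne_top]
      exact ENNReal.mul_ne_top ENNReal.ofReal_ne_top (hinv.trans_lt ENNReal.ofReal_lt_top).ne
    · filter_upwards [hpos] with ω hω
      exact (ENNReal.continuous_ofReal.tendsto _).comp (tendsto_remainderCoeff (mul_pos hc hω))
  have hremlim : ∫⁻ ω, ENNReal.ofReal (σ ^ 2 * (c * ⨆ i, T i ω)⁻¹) ∂μ <
      ENNReal.ofReal (σ ^ 2 * c⁻¹ * κ + δ) := by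
    have : ∀ ω, ENNReal.ofReal (σ ^ 2 * (c * ⨆ i, T i ω)⁻¹) =
        ENNReal.ofReal (σ ^ 2 * c⁻¹) * ENNReal.ofReal (⨆ i, T i ω)⁻¹ := by
      intro ω
      rw [← ENNReal.ofReal_mul (by positivity), mul_inv, mul_assoc]
    simp_rw [this]
    rw [lintegral_const_mul' _ _ ENNReal.ofReal_ne_top]
    refine (mul_le_mul' le_rfl hinv).trans_lt ?_
    rw [← ENNReal.ofReal_mul (by positivity)]
    exact (ENNReal.ofReal_lt_ofReal_iff (by positivity)).mpr (by linarith)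
  filter_upwards [hrem.eventually_lt_const hremlim, self_mem_nhdsWithin] with τ hτ1 hτ
  have hτ0 : 0 < τ := hτ
  have hint := fun Y => integrable_maxTopEig (μ := μ) hn hk2 hc hlaw Y
  set Δ : Ω → ℝ := fun ω => maxTopEig c (fun i => z i ω) (X + τ • V) +
    maxTopEig c (fun i => z i ω) (X - τ • V) - 2 * maxTopEig c (fun i => z i ω) X with hΔ
  have hΔint : Integrable Δ μ := ((hint _).add (hint _)).sub ((hint _).const_mul 2)
  have hΔeq : ∫ ω, Δ ω ∂μ = (∫ ω, maxTopEig c (fun i => z i ω) (X + τ • V) ∂μ) +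
      (∫ ω, maxTopEig c (fun i => z i ω) (X - τ • V) ∂μ) -
      2 * (∫ ω, maxTopEig c (fun i => z i ω) X ∂μ) := by
    have hadd : Integrable (fun ω => maxTopEig c (fun i => z i ω) (X + τ • V) +
        maxTopEig c (fun i => z i ω) (X - τ • V)) μ := (hint _).add (hint _)
    rw [← integral_add (hint _) (hint _), ← integral_const_mul,
      ← integral_sub hadd ((hint _).const_mul 2)]
  have hΔ0 : ∀ ω, 0 ≤ Δ ω := by
    intro ω
    have := maxTopEig_convex_comb_le hn hk2 c (fun i => z i ω) (X + τ • V) (X - τ • V)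
      (a := 1 / 2) (b := 1 / 2) (by norm_num) (by norm_num) (by norm_num)
    have e : (1 / 2 : ℝ) • (X + τ • V) + (1 / 2 : ℝ) • (X - τ • V) = X := by module
    rw [e] at this
    simp only [hΔ]
    linarith
  rw [← hΔeq]
  have hgapbound := lintegral_gap_le hk2 hν hTlaw hTind (a := √2 * (τ * σ) / c) (by positivity)
  have hrho : ∫⁻ ω, ENNReal.ofReal (1 / 2 + 1 / 2 * (⨆ i, T i ω)⁻¹) ∂μ ≤
      ENNReal.ofReal (1 / 2 + 1 / 2 * κ) := by
    calc ∫⁻ ω, ENNReal.ofReal (1 / 2 + 1 / 2 * (⨆ i, T i ω)⁻¹) ∂μ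
        ≤ ∫⁻ ω, (ENNReal.ofReal (1 / 2) +
            ENNReal.ofReal (1 / 2) * ENNReal.ofReal (⨆ i, T i ω)⁻¹) ∂μ := by
          refine lintegral_mono fun ω => ENNReal.ofReal_add_le.trans (le_of_eq ?_)
          rw [ENNReal.ofReal_mul (p := 1 / 2) (by norm_num)]
      _ = ENNReal.ofReal (1 / 2) +
            ENNReal.ofReal (1 / 2) * ∫⁻ ω, ENNReal.ofReal (⨆ i, T i ω)⁻¹ ∂μ := by
          rw [lintegral_add_left measurable_const, lintegral_const, measure_univ, mul_one,
            lintegral_const_mul' _ _ ENNReal.ofReal_ne_top]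
      _ ≤ ENNReal.ofReal (1 / 2) + ENNReal.ofReal (1 / 2) * ENNReal.ofReal κ := by gcongr
      _ = _ := by
          rw [← ENNReal.ofReal_mul (by norm_num), ← ENNReal.ofReal_add (by norm_num)
            (by positivity)]
  have hlint : ∫⁻ ω, ENNReal.ofReal (Δ ω) ∂μ ≤
      ENNReal.ofReal (((k : ℝ) / (k - 2) * c⁻¹ * σ ^ 2 + δ) * τ ^ 2) := by
    calc ∫⁻ ω, ENNReal.ofReal (Δ ω) ∂μ
        ≤ ∫⁻ ω, (ENNReal.ofReal c * (∑ i, {t : Fin k → ℝ | othersMax t i ≤ t i}.indicator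
            (fun t => ENNReal.ofReal (√2 * (τ * σ) / c - (t i - othersMax t i)))
              (fun j => T j ω)) +
            ENNReal.ofReal (τ ^ 2) * ENNReal.ofReal (remainderCoeff σ (c * ⨆ i, T i ω) τ)) ∂μ :=
          lintegral_mono_ae (hpos.mono fun ω hω =>
            ofReal_second_difference_le hn hk2 hc (fun i => z i ω) X V hτ0 hω)
      _ = ENNReal.ofReal c * (∫⁻ ω, ∑ i, {t : Fin k → ℝ | othersMax t i ≤ t i}.indicator
            (fun t => ENNReal.ofReal (√2 * (τ * σ) / c - (t i - othersMax t i)))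
              (fun j => T j ω) ∂μ) + ENNReal.ofReal (τ ^ 2) *
            ∫⁻ ω, ENNReal.ofReal (remainderCoeff σ (c * ⨆ i, T i ω) τ) ∂μ := by
          rw [lintegral_add_right', lintegral_const_mul' _ _ ENNReal.ofReal_ne_top,
            lintegral_const_mul' _ _ ENNReal.ofReal_ne_top]
          exact (((measurable_remainderCoeff σ τ).comp_aemeasurable
            (hsupm.const_mul c)).ennreal_ofReal).const_mul _
      _ ≤ ENNReal.ofReal c * (ENNReal.ofReal ((√2 * (τ * σ) / c) ^ 2 / 2) *
            ENNReal.ofReal (1 / 2 + 1 / 2 * κ)) +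
            ENNReal.ofReal (τ ^ 2) * ENNReal.ofReal (σ ^ 2 * c⁻¹ * κ + δ) := by
          refine add_le_add (mul_le_mul' le_rfl (hgapbound.trans ?_)) (mul_le_mul' le_rfl hτ1.le)
          exact mul_le_mul' le_rfl hrho
      _ = _ := by
          rw [← ENNReal.ofReal_mul (by positivity), ← ENNReal.ofReal_mul hc.le,
            ← ENNReal.ofReal_mul (by positivity), ← ENNReal.ofReal_add (by positivity)
            (by positivity)]
          congr 1
          have h2 : (√2 * (τ * σ) / c) ^ 2 / 2 = τ ^ 2 * σ ^ 2 * c⁻¹ ^ 2 := by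
            rw [div_pow, mul_pow, Real.sq_sqrt zero_le_two, mul_pow, inv_pow, div_eq_mul_inv]
            ring
          -- The gap term gives `1/2 + κ/2` and the remainder gives `κ`, both in units of `σ² / c`.
          have h3 : (k : ℝ) / (k - 2) = 1 / 2 + 3 / 2 * κ := by
            have : (k : ℝ) - 2 ≠ 0 := by linarith
            rw [hκ]
            field_simp
            ring
          rw [h2, h3]
          field_simp
          ring
  rw [← ofReal_integral_eq_lintegral_ofReal hΔint (Eventually.of_forall hΔ0)] at hlint
  refine (ENNReal.ofReal_le_ofReal_iff ?_).mp hlint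
  have : 0 ≤ (k : ℝ) / (k - 2) := div_nonneg (by linarith) (by linarith)
  positivity

end Smoothing

end

/-! ### Differentiability and the Lipschitz constant of the smoothing. -/

theorem mainTheorem1 {Ω : Type*} [MeasurableSpace Ω] (μ : Measure Ω) [IsProbabilityMeasure μ]
    (n k : ℕ) (hn : 1 ≤ n) (hk : 3 ≤ k) (ε : ℝ) (hε : 0 < ε)
    (z : Fin k → Ω → EuclideanSpace ℝ (Fin n))
    (hlaw : ∀ i, HasLaw (z i) (stdGaussian (EuclideanSpace ℝ (Fin n))) μ)
    (hindep : iIndepFun z μ) :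
    (∀ X : SymMatrix n, Integrable (fun ω => maxPerturbed ε (fun i => z i ω) X) μ) ∧
    Differentiable ℝ (smoothedLambdaMax μ ε z) ∧
    ∀ X Y : SymMatrix n,
      ‖gradient (smoothedLambdaMax μ ε z) X - gradient (smoothedLambdaMax μ ε z) Y‖ ≤
        ((k : ℝ) / ((k : ℝ) - 2)) * ((n : ℝ) / ε) * ‖X - Y‖ := by
  have hk2 : 2 ≤ k := by lia
  have hk3 : (3 : ℝ) ≤ k := by exact_mod_cast hk
  have hn0 : (0 : ℝ) < n := by exact_mod_cast hn
  have hc : 0 < ε / n := by positivity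
  have hint := fun X => integrable_maxTopEig (μ := μ) hn hk2 hc hlaw X
  have hF : smoothedLambdaMax μ ε z =
      fun X => ∫ ω, maxTopEig (ε / n) (fun i => z i ω) X ∂μ := by
    funext X
    simp only [smoothedLambdaMax, maxPerturbed_eq_maxTopEig]
  refine ⟨fun X => by simpa only [maxPerturbed_eq_maxTopEig] using hint X, ?_⟩
  rw [hF, ← inv_div ε (n : ℝ)]
  refine differentiable_and_lipschitz_gradient ?_ ⟨convex_univ, ?_⟩
    (mul_pos (div_pos (by linarith) (by linarith)) (inv_pos.mpr hc))
    fun X V δ hδ => eventually_second_difference_le hn hk hc hlaw hindep X V hδ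
  · refine LipschitzWith.continuous (K := 1) (LipschitzWith.of_le_add fun X Y => ?_)
    calc ∫ ω, maxTopEig (ε / n) (fun i => z i ω) X ∂μ
        ≤ ∫ ω, (maxTopEig (ε / n) (fun i => z i ω) Y + dist X Y) ∂μ := by
          refine integral_mono (hint X) ((hint Y).add (integrable_const _)) fun ω => ?_
          have := maxTopEig_add_le hn hk2 (ε / n) (fun i => z i ω) Y (X - Y)
          rwa [add_sub_cancel, ← dist_eq_norm] at this
      _ = _ := by rw [integral_add (hint Y) (integrable_const _)]; simp
  · intro X _ Y _ a b ha hb hab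
    simp only [smul_eq_mul]
    rw [← integral_const_mul, ← integral_const_mul,
      ← integral_add ((hint X).const_mul a) ((hint Y).const_mul b)]
    exact integral_mono (hint _) (((hint X).const_mul a).add ((hint Y).const_mul b))
      fun ω => maxTopEig_convex_comb_le hn hk2 _ _ X Y ha hb hab
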